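/- Let $H,S,\Delta_H,\Delta_S$ be $n\times n$ complex Hermitian matrices with $S$ positive semidefinite, and put $\tilde H=H+\Delta_H$, $\tilde S=S+\Delta_S$, $\eta_H=\|\Delta_H\|$, $\eta_S=\|\Delta_S\|$, where $\|\cdot\|$ is the spectral norm. Let $v_1,\dots,v_n$ be an orthonormal basis of eigenvectors of $S$ with eigenvalues $\lambda_1\ge\dots\ge\lambda_n\ge 0$, and $\tilde v_1,\dots,\tilde v_n$ an orthonormal basis of eigenvectors of $\tilde S$ with eigenvalues $\tilde\lambda_1\ge\dots\ge\tilde\lambda_n$. Let $\epsilon>0$, let $V$ be the matrix whose columns are the $v_i$ with $\lambda_i>\epsilon$, and $\tilde V$ the matrix whose columns are the $\tilde v_i$ with $\tilde\lambda_i>\epsilon$. Assume: 1. for some $\mu>0$ and $0\le\alpha\le 1/2$, $|v_i^*Hv_j|\le\mu\,\min(\lambda_i,\lambda_j)^{1-\alpha}\max(\lambda_i,\lambda_j)^{\alpha}$ for all $1\le i,j\le n$; 2. for some $\rho>0$ and some index $1\le m\le n$, $\lambda_{m+1}+\eta_S\le\epsilon<(1+\rho)\epsilon\le\lambda_m$ (the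 first inequality is void if $m=n$); 3. $(1+\rho^{-1})\eta_S/\epsilon\le 1$. Put $(A,B)=(V^*HV,V^*SV)$ and $$\chi=3(2+\mu)n^3(1+\rho^{-1})\Big(\frac{\|S\|}{\epsilon}\Big)^{\alpha}\eta_S+\eta_H .$$ An eigenvalue of a pair $(M,N)$ is a number $E$ with $Mx=E\,Nx$ for some $x\ne0$, called an eigenvector. Then there is a pair $(A',B')$ with $$\sqrt{\|A'-A\|^2+\|B'-B\|^2}\le\chi$$ that is $*$-congruent to the thresholded noisy pair $(\tilde V^*\tilde H\tilde V,\tilde V^*\tilde S\tilde V)$, that is, $(A',B')=(W^*\tilde V^*\tilde H\tilde VW,\,W^*\tilde V^*\tilde S\tilde VW)$ for some invertible $W$; in particular the two pairs have the same eigenvalues, with multiplicities. Let $E_0\le E_1\le\dots\le E_{m-1}$ be the eigenvalues of $(A,B)$, repeated by multiplicity, let $x_0$ be a unit eigenvector of $(A,B)$ for $E_0$, and let $d_0=|x_0^*(A+\mathrm iB)x_0|$ (so that $d_0^{-1}$ is the condition number of the eigenangle $\tan^{-1}E_0$). Suppose further that $n\chi\le\epsilon$ and, if $m\ge2$, that $\tan^{-1}E_1-\tan^{-1}E_0\ge\sin^{-1}(n\chi/\epsilon)$.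 Then $(\tilde V^*\tilde H\tilde V,\tilde V^*\tilde S\tilde V)$ has a least eigenvalue $\tilde E_0$ (the value recovered by thresholding), and $$\left|\tan^{-1}E_0-\tan^{-1}\tilde E_0\right|\le\sin^{-1}\frac{n\chi}{d_0}.$$ -/

import Mathlib

open Matrix
open scoped Matrix.Norms.L2Operator ComplexOrder

/-- `(V, lam)` is an eigendecomposition of the `n × n` matrix `S`: the columns of the unitary
matrix `V` are eigenvectors of `S`, arranged in decreasing order of their (real) eigenvalues. -/
structure IsEigendecomposition {n : ℕ} (S V : Matrix (Fin n) (Fin n) ℂ) (lam : Fin n → ℝ) :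
    Prop where
  unitary : V ∈ Matrix.unitaryGroup (Fin n) ℂ
  antitone : Antitone lam
  eigen : S * V = V * Matrix.diagonal (fun i => (lam i : ℂ))

/-- The indices of the eigenvalues that survive thresholding at level `ε`. -/
abbrev Kept {n : ℕ} (lam : Fin n → ℝ) (ε : ℝ) : Type := {i : Fin n // ε < lam i}

/-- The columns of `V` that belong to eigenvalues greater than `ε`. -/
def keptColumns {n : ℕ} (V : Matrix (Fin n) (Fin n) ℂ) (lam : Fin n → ℝ) (ε : ℝ) :
    Matrix (Fin n) (Kept lam ε) ℂ :=
  V.submatrix id Subtype.val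

/-- The compression `V_{>ε}ᴴ M V_{>ε}` of `M` to the eigenvectors that survive thresholding. -/
noncomputable def thresholded {n : ℕ} (M V : Matrix (Fin n) (Fin n) ℂ) (lam : Fin n → ℝ)
    (ε : ℝ) : Matrix (Kept lam ε) (Kept lam ε) ℂ :=
  (keptColumns V lam ε)ᴴ * M * keptColumns V lam ε

/-- The weighted geometric mean bound
`|v_iᴴ H v_j| ≤ μ min(λ_i, λ_j)^(1-α) max(λ_i, λ_j)^α`, where `v_i` is the `i`-th column of `V`. -/
def GeometricMeanBound {n : ℕ} (H V : Matrix (Fin n) (Fin n) ℂ) (lam : Fin n → ℝ)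
    (μ α : ℝ) : Prop :=
  ∀ i j, ‖star (V.col i) ⬝ᵥ (H *ᵥ V.col j)‖ ≤
    μ * min (lam i) (lam j) ^ (1 - α) * max (lam i) (lam j) ^ α

/-- The gap condition `λ_{m+1} + η ≤ ε < (1+ρ) ε ≤ λ_m` for an index `1 ≤ m ≤ n`, the eigenvalues
being numbered from one in the text and from zero in the code. For `m = n` there is no
`λ_{m+1}`, and the first inequality is void. -/
def SpectralGap {n : ℕ} (lam : Fin n → ℝ) (m : ℕ) (η ε ρ : ℝ) : Prop :=
  0 < m ∧ m ≤ n ∧ (∀ i : Fin n, i.val = m → lam i + η ≤ ε) ∧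
    ε < (1 + ρ) * ε ∧ (∀ i : Fin n, i.val + 1 = m → (1 + ρ) * ε ≤ lam i)

/-- `E` is an eigenvalue of the pair `(A, B)` with eigenvector `x`: `A x = E B x`, `x ≠ 0`. -/
def IsPairEigenvector {ι : Type*} [Fintype ι] (A B : Matrix ι ι ℂ) (E : ℝ) (x : ι → ℂ) : Prop :=
  x ≠ 0 ∧ A *ᵥ x = (E : ℂ) • (B *ᵥ x)

/-- The (real) eigenvalues of the pair `(A, B)`; a Hermitian pair with `B` positive definite has
no others. -/
def pairEigenvalues {ι : Type*} [Fintype ι] (A B : Matrix ι ι ℂ) : Set ℝ :=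
  {E | ∃ x, IsPairEigenvector A B E x}

/-- `E 0 ≤ E 1 ≤ …` are all the eigenvalues of the pair `(A, B)`, repeated by multiplicity
(for a Hermitian pair with `B` positive definite). -/
def IsEigenvalueSequence {ι : Type*} [Fintype ι] (A B : Matrix ι ι ℂ) {q : ℕ}
    (E : Fin q → ℝ) : Prop :=
  Monotone E ∧ ∃ x : Module.Basis (Fin q) ℂ (ι → ℂ), ∀ j, IsPairEigenvector A B (E j) (x j)

/-- The pair `(A', B')` is `(Wᴴ A W, Wᴴ B W)` for some invertible `W`. -/
def StarCongruent {ι κ : Type*} [Fintype ι] [DecidableEq ι] [Fintype κ] [DecidableEq κ]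
    (A B : Matrix ι ι ℂ) (A' B' : Matrix κ κ ℂ) : Prop :=
  ∃ (W : Matrix ι κ ℂ) (W' : Matrix κ ι ℂ), W * W' = 1 ∧ W' * W = 1 ∧
    A' = Wᴴ * A * W ∧ B' = Wᴴ * B * W

/-- `|xᴴ (A + iB) x|`. For a unit eigenvector `x` of a simple eigenvalue `E` of `(A, B)`, this is
the reciprocal of the condition number of the eigenangle `arctan E`. -/
noncomputable def eigenangleDist {ι : Type*} [Fintype ι] (A B : Matrix ι ι ℂ) (x : ι → ℂ) : ℝ :=
  ‖star x ⬝ᵥ ((A + Complex.I • B) *ᵥ x)‖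

/-- The error level
`χ = 3 (2 + μ) n³ (1 + ρ⁻¹) (‖S‖ / ε)^α ηS + ηH`, with `‖S‖` the spectral norm. -/
noncomputable def errorLevel {n : ℕ} (S : Matrix (Fin n) (Fin n) ℂ) (μ α ρ ε ηS ηH : ℝ) : ℝ :=
  3 * (2 + μ) * (n : ℝ) ^ 3 * (1 + ρ⁻¹) * (‖S‖ / ε) ^ α * ηS + ηH

/-
Idea. Let `W = Ṽᴴ V`, the matrix of the projection of the kept eigenvectors of `S` onto the kept
eigenspace of `S̃ = S + ΔS`. The spectral gap makes `W` invertible, so `Wᴴ (·) W` carries the noisy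
thresholded pair to a `*`-congruent one. To compare the latter with `(A, B)`, work in the
eigenbasis of `S`: the compression of `K` becomes `(1 - Q) h (1 - Q)` with `h = Vᴴ K V` and
`|Q i j| ≤ l i l j`, where `l i` is the norm of the component of `v i` outside the kept eigenspace
of `S̃`. By the Davis–Kahan argument `λ i l i ≲ ‖ΔS‖` for the kept `i`, and the geometric mean bound
on `h` is what turns one factor `l` of each entry of `Q h` into this small quantity. The matrix `S`
itself satisfies the geometric mean bound with `μ = 1`, so the same estimate serves for `B`.

For the angles, rotate the pair: `θ = arctan E` lies above `ψ` exactly when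
`cos ψ A - sin ψ B` is positive at the eigenvector, and this matrix moves by at most `χ` when the
pair does. Testing it at `x₀` bounds the least noisy angle from above; for `ψ` a
little below `arctan E₀` its form is at least `χ ‖y‖²` at every `y`, which bounds that angle from
below.
-/

/-- The real part of the quadratic form `xᴴ M x`; for Hermitian `M` the form itself. -/
noncomputable def quadForm {ι : Type*} [Fintype ι] (M : Matrix ι ι ℂ) (x : ι → ℂ) : ℝ :=
  (star x ⬝ᵥ (M *ᵥ x)).re

/-- The squared Euclidean norm. The type `ι → ℂ` itself carries the sup norm. -/
noncomputable def sqNorm {ι : Type*} [Fintype ι] (x : ι → ℂ) : ℝ := ∑ i, ‖x i‖ ^ 2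

section Forms

variable {ι κ : Type*} [Fintype ι] [Fintype κ]

theorem sqNorm_nonneg (x : ι → ℂ) : 0 ≤ sqNorm x := Finset.sum_nonneg fun _ _ => by positivity

theorem sqNorm_eq_norm_sq (x : ι → ℂ) :
    sqNorm x = ‖(WithLp.toLp 2 x : EuclideanSpace ℂ ι)‖ ^ 2 :=
  (EuclideanSpace.norm_sq_eq _).symm

theorem star_dotProduct_self (x : ι → ℂ) : star x ⬝ᵥ x = (sqNorm x : ℂ) := by
  simp [dotProduct, sqNorm, Complex.conj_mul']

theorem sqNorm_smul (c : ℂ) (x : ι → ℂ) : sqNorm (c • x) = ‖c‖ ^ 2 * sqNorm x := by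
  simp [sqNorm, mul_pow, Finset.mul_sum]

theorem sqNorm_add_le (x y : ι → ℂ) : sqNorm (x + y) ≤ 2 * (sqNorm x + sqNorm y) := by
  simp only [sqNorm, ← Finset.sum_add_distrib, Finset.mul_sum]
  refine Finset.sum_le_sum fun i _ => ?_
  exact (pow_le_pow_left₀ (norm_nonneg _) (norm_add_le _ _) 2).trans add_sq_le

theorem quadForm_sub (M N : Matrix ι ι ℂ) (x : ι → ℂ) :
    quadForm (M - N) x = quadForm M x - quadForm N x := by
  simp [quadForm, sub_mulVec, dotProduct_sub]

theorem quadForm_ofReal_smul (r : ℝ) (M : Matrix ι ι ℂ) (x : ι → ℂ) :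
    quadForm ((r : ℂ) • M) x = r * quadForm M x := by
  simp [quadForm, smul_mulVec]

theorem quadForm_smul (M : Matrix ι ι ℂ) (c : ℂ) (x : ι → ℂ) :
    quadForm M (c • x) = ‖c‖ ^ 2 * quadForm M x := by
  have : star (c • x) ⬝ᵥ (M *ᵥ (c • x)) = ((‖c‖ ^ 2 : ℝ) : ℂ) * (star x ⬝ᵥ (M *ᵥ x)) := by
    rw [star_smul, mulVec_smul, smul_dotProduct, dotProduct_smul, smul_smul, smul_eq_mul,
      Complex.star_def, Complex.conj_mul', Complex.ofReal_pow]
  rw [quadForm, this, Complex.re_ofReal_mul, quadForm]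

theorem quadForm_conjTranspose_mul_mul (M : Matrix ι ι ℂ) (W : Matrix ι κ ℂ) (x : κ → ℂ) :
    quadForm (Wᴴ * M * W) x = quadForm M (W *ᵥ x) := by
  simp only [quadForm, ← mulVec_mulVec, star_mulVec, dotProduct_mulVec, vecMul_vecMul,
    Matrix.mul_assoc]

theorem quadForm_diagonal [DecidableEq ι] (d : ι → ℝ) (x : ι → ℂ) :
    quadForm (diagonal fun i => (d i : ℂ)) x = ∑ i, d i * ‖x i‖ ^ 2 := by
  rw [quadForm, dotProduct, Complex.re_sum]
  refine Finset.sum_congr rfl fun i _ => ?_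
  rw [mulVec_diagonal, mul_left_comm, Pi.star_apply, Complex.star_def, Complex.conj_mul',
    Complex.re_ofReal_mul, ← Complex.ofReal_pow, Complex.ofReal_re]

theorem coe_quadForm {M : Matrix ι ι ℂ} (hM : M.IsHermitian) (x : ι → ℂ) :
    (quadForm M x : ℂ) = star x ⬝ᵥ (M *ᵥ x) :=
  Complex.ext (by simp [quadForm]) (by simpa using (hM.im_star_dotProduct_mulVec_self x).symm)

theorem star_dotProduct_mulVec_comm {M : Matrix ι ι ℂ} (hM : M.IsHermitian) (x y : ι → ℂ) :
    star x ⬝ᵥ (M *ᵥ y) = star (star y ⬝ᵥ (M *ᵥ x)) := by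
  rw [star_dotProduct, star_mulVec, hM.eq, ← dotProduct_mulVec]

theorem quadForm_add_of_orthogonal {M : Matrix ι ι ℂ} (hM : M.IsHermitian) {x y : ι → ℂ}
    (h : star x ⬝ᵥ (M *ᵥ y) = 0) : quadForm M (x + y) = quadForm M x + quadForm M y := by
  have h' : star y ⬝ᵥ (M *ᵥ x) = 0 := by rw [star_dotProduct_mulVec_comm hM, h, star_zero]
  simp only [quadForm, star_add, mulVec_add, dotProduct_add, add_dotProduct, h, h',
    Complex.add_re, Complex.zero_re]
  ring

theorem quadForm_pos {B : Matrix ι ι ℂ} (hB : B.PosDef) {x : ι → ℂ} (hx : x ≠ 0) :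
    0 < quadForm B x :=
  hB.re_dotProduct_pos hx

theorem star_sum_dotProduct_mulVec_sum (M : Matrix ι ι ℂ) (x : κ → ι → ℂ) (c : κ → ℂ) :
    star (∑ j, c j • x j) ⬝ᵥ (M *ᵥ ∑ j, c j • x j) =
      ∑ i, ∑ j, star (c i) * c j * (star (x i) ⬝ᵥ (M *ᵥ x j)) := by
  simp only [star_sum, star_smul, sum_dotProduct, smul_dotProduct, smul_eq_mul,
    Matrix.mulVec_sum, dotProduct_sum, mulVec_smul, dotProduct_smul, Finset.mul_sum, mul_assoc]
  rw [Finset.sum_comm]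
  exact Finset.sum_congr rfl fun i _ => Finset.sum_congr rfl fun j _ => by ring

theorem abs_quadForm_le [DecidableEq ι] (M : Matrix ι ι ℂ) (x : ι → ℂ) :
    |quadForm M x| ≤ ‖M‖ * sqNorm x := by
  set v : EuclideanSpace ℂ ι := WithLp.toLp 2 x
  have hinner : star x ⬝ᵥ (M *ᵥ x) = inner ℂ v (WithLp.toLp 2 (M *ᵥ x)) := by
    rw [EuclideanSpace.inner_toLp_toLp, dotProduct_comm]
  calc |quadForm M x| ≤ ‖star x ⬝ᵥ (M *ᵥ x)‖ := Complex.abs_re_le_norm _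
    _ ≤ ‖v‖ * ‖(WithLp.toLp 2 (M *ᵥ x) : EuclideanSpace ℂ ι)‖ := by
        rw [hinner]; exact norm_inner_le_norm _ _
    _ ≤ ‖v‖ * (‖M‖ * ‖v‖) := by gcongr; exact M.l2_opNorm_mulVec v
    _ = ‖M‖ * sqNorm x := by rw [sqNorm_eq_norm_sq]; ring

end Forms

section Pairs

variable {ι κ τ : Type*} [Fintype ι] [Fintype κ] {A B : Matrix ι ι ℂ} {E F : ℝ} {x y : ι → ℂ}

theorem IsPairEigenvector.quadForm_eq (h : IsPairEigenvector A B E x) :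
    quadForm A x = E * quadForm B x := by
  rw [quadForm, h.2, dotProduct_smul, smul_eq_mul, Complex.re_ofReal_mul, quadForm]

theorem IsPairEigenvector.orthogonal (hA : A.IsHermitian) (hB : B.IsHermitian)
    (hx : IsPairEigenvector A B E x) (hy : IsPairEigenvector A B F y) (hEF : E ≠ F) :
    star x ⬝ᵥ (B *ᵥ y) = 0 := by
  have h := star_dotProduct_mulVec_comm hA x y
  rw [hx.2, hy.2, dotProduct_smul, dotProduct_smul, star_smul,
    ← star_dotProduct_mulVec_comm hB] at h
  simp only [smul_eq_mul, Complex.star_def, Complex.conj_ofReal] at h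
  have h' : ((F : ℂ) - E) * (star x ⬝ᵥ (B *ᵥ y)) = 0 := by linear_combination h
  exact (mul_eq_zero.mp h').resolve_left
    (sub_ne_zero.mpr (Complex.ofReal_injective.ne hEF.symm))

section Congruence

variable [DecidableEq ι] [DecidableEq κ] {A' B' : Matrix κ κ ℂ}

theorem StarCongruent.symm (h : StarCongruent A B A' B') : StarCongruent A' B' A B := by
  obtain ⟨W, W', hWW', hW'W, rfl, rfl⟩ := h
  have hstar : W'ᴴ * Wᴴ = 1 := by rw [← conjTranspose_mul, hWW', conjTranspose_one]
  have cancel (M : Matrix ι ι ℂ) : M = W'ᴴ * (Wᴴ * M * W) * W' :=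
    calc M = (W'ᴴ * Wᴴ) * M * (W * W') := by rw [hstar, hWW', Matrix.one_mul, Matrix.mul_one]
      _ = _ := by simp only [Matrix.mul_assoc]
  exact ⟨W', W, hW'W, hWW', cancel A, cancel B⟩

theorem StarCongruent.exists_linearEquiv (h : StarCongruent A B A' B') :
    ∃ e : (κ → ℂ) ≃ₗ[ℂ] (ι → ℂ), ∀ {E : ℝ} {x : κ → ℂ},
      IsPairEigenvector A' B' E x → IsPairEigenvector A B E (e x) := by
  obtain ⟨W, W', hWW', hW'W, rfl, rfl⟩ := h
  have hstar : W'ᴴ * Wᴴ = 1 := by rw [← conjTranspose_mul, hWW', conjTranspose_one]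
  refine ⟨(Matrix.toLin'OfInv hWW' hW'W).symm, fun {E x} hx => ?_⟩
  refine ⟨(LinearEquiv.map_ne_zero_iff _).mpr hx.1, ?_⟩
  change A *ᵥ (W *ᵥ x) = (E : ℂ) • (B *ᵥ (W *ᵥ x))
  have h := congrArg (W'ᴴ *ᵥ ·) hx.2
  simpa only [mulVec_smul, mulVec_mulVec, ← Matrix.mul_assoc, hstar, Matrix.one_mul] using h

theorem StarCongruent.isEigenvalueSequence_iff (h : StarCongruent A B A' B') {q : ℕ}
    {E : Fin q → ℝ} : IsEigenvalueSequence A B E ↔ IsEigenvalueSequence A' B' E := by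
  constructor
  · rintro ⟨hmono, x, hx⟩
    obtain ⟨e, he⟩ := h.symm.exists_linearEquiv
    exact ⟨hmono, x.map e, fun j => he (hx j)⟩
  · rintro ⟨hmono, x, hx⟩
    obtain ⟨e, he⟩ := h.exists_linearEquiv
    exact ⟨hmono, x.map e, fun j => he (hx j)⟩

theorem StarCongruent.pairEigenvalues_eq (h : StarCongruent A B A' B') :
    pairEigenvalues A B = pairEigenvalues A' B' := by
  obtain ⟨e, he⟩ := h.exists_linearEquiv
  obtain ⟨e', he'⟩ := h.symm.exists_linearEquiv
  exact Set.Subset.antisymm (fun E ⟨x, hx⟩ => ⟨e' x, he' hx⟩) fun E ⟨x, hx⟩ => ⟨e x, he hx⟩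

theorem StarCongruent.isHermitian (h : StarCongruent A B A' B') (hA : A.IsHermitian) :
    A'.IsHermitian := by
  obtain ⟨W, -, -, -, rfl, -⟩ := h
  exact isHermitian_conjTranspose_mul_mul W hA

theorem StarCongruent.posDef (h : StarCongruent A B A' B') (hB : B.PosDef) : B'.PosDef := by
  obtain ⟨W, W', -, hW'W, -, rfl⟩ := h
  exact hB.conjTranspose_mul_mul_same (Function.LeftInverse.injective (g := W'.mulVec)
    fun x => by rw [mulVec_mulVec, hW'W, one_mulVec])

end Congruence

theorem exists_basis_isPairEigenvector (hA : A.IsHermitian) (hB : B.PosDef) :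
    ∃ (x : Module.Basis ι ℂ (ι → ℂ)) (E : ι → ℝ), ∀ j, IsPairEigenvector A B (E j) (x j) := by
  classical
  open scoped MatrixOrder in
  obtain ⟨C, hC⟩ := CStarAlgebra.nonneg_iff_eq_star_mul_self.mp hB.posSemidef.nonneg
  rw [star_eq_conjTranspose] at hC
  have hdet : IsUnit C.det := by
    have h := (isUnit_iff_isUnit_det B).mp hB.isUnit
    rw [hC, det_mul] at h
    exact isUnit_of_mul_isUnit_right h
  have hinv : C * C⁻¹ = 1 := mul_nonsing_inv C hdet
  have hcong : StarCongruent A B ((C⁻¹)ᴴ * A * C⁻¹) 1 := by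
    refine ⟨C⁻¹, C, nonsing_inv_mul C hdet, hinv, rfl, ?_⟩
    calc (1 : Matrix ι ι ℂ) = (C * C⁻¹)ᴴ * (C * C⁻¹) := by
          rw [hinv, conjTranspose_one, Matrix.one_mul]
      _ = (C⁻¹)ᴴ * B * C⁻¹ := by rw [hC, conjTranspose_mul]; simp only [Matrix.mul_assoc]
  have hM := hcong.isHermitian hA
  obtain ⟨e, he⟩ := hcong.exists_linearEquiv
  let u := hM.eigenvectorBasis.toBasis.map (WithLp.linearEquiv 2 ℂ (ι → ℂ))
  refine ⟨u.map e, hM.eigenvalues, fun j => he ⟨u.ne_zero j, ?_⟩⟩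
  rw [one_mulVec]
  simpa [u] using hM.mulVec_eigenvectorBasis j

theorem mul_quadForm_le_of_repr [Finite τ] (hA : A.IsHermitian) (hB : B.PosSemidef)
    (x : Module.Basis τ ℂ (ι → ℂ)) {E : τ → ℝ} (hx : ∀ j, IsPairEigenvector A B (E j) (x j))
    {t : ℝ} (hy : ∀ j, x.repr y j ≠ 0 → t ≤ E j) : t * quadForm B y ≤ quadForm A y := by
  cases nonempty_fintype τ
  set c : τ → ℂ := fun j => x.repr y j
  -- `x` need not be `B`-orthogonal inside an eigenspace, so instead of a sum of squares the
  -- difference of the two forms at `y` is written as the form of `B` at a single vector `w`.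
  set w : ι → ℂ := ∑ j, (c j * (√(E j - t) : ℂ)) • x j with hw
  have key : star y ⬝ᵥ (A *ᵥ y) - (t : ℂ) * (star y ⬝ᵥ (B *ᵥ y)) = star w ⬝ᵥ (B *ᵥ w) := by
    rw [hw, ← x.sum_repr y, star_sum_dotProduct_mulVec_sum, star_sum_dotProduct_mulVec_sum,
      star_sum_dotProduct_mulVec_sum]
    simp only [Finset.mul_sum, ← Finset.sum_sub_distrib]
    refine Finset.sum_congr rfl fun i _ => Finset.sum_congr rfl fun j _ => ?_
    rw [(hx j).2, dotProduct_smul, smul_eq_mul]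
    change star (c i) * c j * _ - t * (star (c i) * c j * _) = _
    by_cases hj : c j = 0
    · simp only [hj, mul_zero, zero_mul, sub_self]
    by_cases hij : E i = E j
    · have hsqrt : (√(E j - t) : ℂ) * (√(E j - t) : ℂ) = (E j : ℂ) - t := by
        rw [← Complex.ofReal_mul, Real.mul_self_sqrt (sub_nonneg.mpr (hy j hj)),
          Complex.ofReal_sub]
      rw [hij, star_mul', Complex.star_def, Complex.conj_ofReal]
      linear_combination (-(starRingEnd ℂ (c i)) * c j * (star (x i) ⬝ᵥ (B *ᵥ x j))) * hsqrt
    · rw [(hx i).orthogonal hA hB.isHermitian (hx j) hij]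
      ring
  have hnonneg : 0 ≤ (star w ⬝ᵥ (B *ᵥ w)).re := hB.re_dotProduct_nonneg w
  rw [← key, Complex.sub_re, Complex.re_ofReal_mul] at hnonneg
  exact sub_nonneg.mp hnonneg

theorem exists_isLeast_pairEigenvalues [Nonempty ι] (hA : A.IsHermitian) (hB : B.PosDef) :
    ∃ F, IsLeast (pairEigenvalues A B) F := by
  obtain ⟨x, E, hx⟩ := exists_basis_isPairEigenvector hA hB
  obtain ⟨j, hj⟩ := Finite.exists_min E
  refine ⟨E j, ⟨x j, hx j⟩, fun G ⟨y, hy⟩ => ?_⟩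
  have h := mul_quadForm_le_of_repr hA hB.posSemidef x hx (y := y) fun i _ => hj i
  rw [hy.quadForm_eq] at h
  exact le_of_mul_le_mul_right h (quadForm_pos hB hy.1)

theorem mul_quadForm_le_of_mem_lowerBounds (hA : A.IsHermitian) (hB : B.PosDef) {t : ℝ}
    (ht : t ∈ lowerBounds (pairEigenvalues A B)) (y : ι → ℂ) :
    t * quadForm B y ≤ quadForm A y := by
  obtain ⟨x, E, hx⟩ := exists_basis_isPairEigenvector hA hB
  exact mul_quadForm_le_of_repr hA hB.posSemidef x hx fun j _ => ht ⟨x j, hx j⟩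

section Simple

variable [Finite τ] {E : τ → ℝ} {x₀ z : ι → ℂ} {j₀ : τ}

theorem repr_eq_zero_of_orthogonal (hA : A.IsHermitian) (hB : B.PosDef)
    (x : Module.Basis τ ℂ (ι → ℂ)) (hx : ∀ j, IsPairEigenvector A B (E j) (x j))
    (hx₀ : IsPairEigenvector A B (E j₀) x₀) (hsimple : ∀ j, j ≠ j₀ → E j₀ ≠ E j)
    (hz : star x₀ ⬝ᵥ (B *ᵥ z) = 0) : x.repr z j₀ = 0 := by
  classical
  cases nonempty_fintype τ
  have expand (v : ι → ℂ) :
      star x₀ ⬝ᵥ (B *ᵥ v) = x.repr v j₀ * (star x₀ ⬝ᵥ (B *ᵥ x j₀)) := by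
    conv_lhs => rw [← x.sum_repr v, Matrix.mulVec_sum, dotProduct_sum]
    rw [Finset.sum_eq_single j₀, mulVec_smul, dotProduct_smul, smul_eq_mul]
    · intro j _ hj
      rw [mulVec_smul, dotProduct_smul,
        hx₀.orthogonal hA hB.isHermitian (hx j) (hsimple j hj), smul_zero]
    · exact fun h => (h (Finset.mem_univ j₀)).elim
  rw [expand, mul_eq_zero] at hz
  refine hz.resolve_right fun h => (quadForm_pos hB hx₀.1).ne' ?_
  rw [quadForm, expand, h, mul_zero, Complex.zero_re]

theorem mul_quadForm_le_of_orthogonal (hA : A.IsHermitian) (hB : B.PosDef)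
    (x : Module.Basis τ ℂ (ι → ℂ)) (hx : ∀ j, IsPairEigenvector A B (E j) (x j))
    (hx₀ : IsPairEigenvector A B (E j₀) x₀) {t : ℝ} (ht : ∀ j, j ≠ j₀ → t ≤ E j)
    (hz : star x₀ ⬝ᵥ (B *ᵥ z) = 0) : t * quadForm B z ≤ quadForm A z := by
  refine mul_quadForm_le_of_repr hA hB.posSemidef x hx fun j hj => ?_
  rcases eq_or_ne j j₀ with rfl | hne
  · by_contra! hlt
    exact hj (repr_eq_zero_of_orthogonal hA hB x hx hx₀ (fun i hi => (hlt.trans_le (ht i hi)).ne)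
      hz)
  · exact ht j hne

theorem exists_eq_smul_add_orthogonal (hB : B.PosDef) (hx₀ : x₀ ≠ 0) (y : ι → ℂ) :
    ∃ (c : ℂ) (z : ι → ℂ), y = c • x₀ + z ∧ star x₀ ⬝ᵥ (B *ᵥ z) = 0 := by
  have hne : star x₀ ⬝ᵥ (B *ᵥ x₀) ≠ 0 := (hB.dotProduct_mulVec_pos hx₀).ne'
  set c := star x₀ ⬝ᵥ (B *ᵥ y) / star x₀ ⬝ᵥ (B *ᵥ x₀)
  refine ⟨c, y - c • x₀, (add_sub_cancel _ _).symm, ?_⟩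
  rw [mulVec_sub, mulVec_smul, dotProduct_sub, dotProduct_smul, smul_eq_mul,
    div_mul_cancel₀ _ hne, sub_self]

theorem mul_add_le_quadForm_smul_add (hA : A.IsHermitian) (hB : B.PosDef) {ε s : ℝ} (hε : 0 < ε)
    (hs : 0 ≤ s) (hBε : ∀ y, ε * sqNorm y ≤ quadForm B y) (x : Module.Basis τ ℂ (ι → ℂ))
    (hx : ∀ j, IsPairEigenvector A B (E j) (x j)) (hx₀ : IsPairEigenvector A B (E j₀) x₀)
    (hs₀ : s ≤ quadForm A x₀) (hsE : ∀ j, j ≠ j₀ → s / ε ≤ E j) (c : ℂ)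
    (hz : star x₀ ⬝ᵥ (B *ᵥ z) = 0) :
    s * (‖c‖ ^ 2 + sqNorm z) ≤ quadForm A (c • x₀ + z) := by
  have horth : star (c • x₀) ⬝ᵥ (A *ᵥ z) = 0 := by
    rw [star_smul, smul_dotProduct, star_dotProduct_mulVec_comm hA, hx₀.2, dotProduct_smul,
      star_smul, ← star_dotProduct_mulVec_comm hB.isHermitian, hz, smul_zero, smul_zero]
  calc s * (‖c‖ ^ 2 + sqNorm z) = ‖c‖ ^ 2 * s + s / ε * (ε * sqNorm z) := by
        rw [← mul_assoc (s / ε), div_mul_cancel₀ _ hε.ne']; ring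
    _ ≤ ‖c‖ ^ 2 * quadForm A x₀ + s / ε * quadForm B z := by gcongr; exact hBε z
    _ ≤ ‖c‖ ^ 2 * quadForm A x₀ + quadForm A z := by
        gcongr; exact mul_quadForm_le_of_orthogonal hA hB x hx hx₀ hsE hz
    _ = quadForm A (c • x₀ + z) := by rw [quadForm_add_of_orthogonal hA horth, quadForm_smul]

/-- The splitting of `y` along `x₀` is `B`-orthogonal but not orthogonal, which costs the factor
`2`; in dimension one there is nothing to split. -/
theorem mul_sqNorm_le_quadForm {q : ℕ} {E : Fin q → ℝ} {j₀ : Fin q} (hA : A.IsHermitian)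
    (hB : B.PosDef) {ε χ : ℝ} (hε : 0 < ε) (hχ : 0 ≤ χ)
    (hBε : ∀ y, ε * sqNorm y ≤ quadForm B y) (x : Module.Basis (Fin q) ℂ (ι → ℂ))
    (hx : ∀ j, IsPairEigenvector A B (E j) (x j)) (hx₀ : IsPairEigenvector A B (E j₀) x₀)
    (hx₀1 : sqNorm x₀ = 1) (hχ₀ : (min q 2 : ℕ) * χ ≤ quadForm A x₀)
    (hχE : ∀ j, j ≠ j₀ → (min q 2 : ℕ) * χ / ε ≤ E j) (y : ι → ℂ) :
    χ * sqNorm y ≤ quadForm A y := by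
  rcases Nat.lt_or_ge q 2 with hq | hq
  · have hq1 : q = 1 := by have := j₀.2; omega
    have hdim : Module.finrank ℂ (ι → ℂ) = 1 := by
      rw [Module.finrank_eq_card_basis x, Fintype.card_fin, hq1]
    obtain ⟨c, rfl⟩ := (finrank_eq_one_iff_of_nonzero' x₀ hx₀.1).mp hdim y
    rw [sqNorm_smul, quadForm_smul, hx₀1, mul_one, mul_comm]
    gcongr
    simpa [hq1] using hχ₀
  · rw [min_eq_right hq, Nat.cast_ofNat] at hχ₀ hχE
    obtain ⟨c, z, rfl, hz⟩ := exists_eq_smul_add_orthogonal hB hx₀.1 y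
    calc χ * sqNorm (c • x₀ + z) ≤ χ * (2 * (sqNorm (c • x₀) + sqNorm z)) := by
          gcongr; exact sqNorm_add_le _ _
      _ = 2 * χ * (‖c‖ ^ 2 + sqNorm z) := by rw [sqNorm_smul, hx₀1]; ring
      _ ≤ quadForm A (c • x₀ + z) :=
          mul_add_le_quadForm_smul_add hA hB hε (by positivity) hBε x hx hx₀ hχ₀ hχE c hz

end Simple

end Pairs

section Angles

variable {E ψ : ℝ}

theorem mul_cos_sub_sin_eq (E ψ : ℝ) :
    E * Real.cos ψ - Real.sin ψ = √(1 + E ^ 2) * Real.sin (Real.arctan E - ψ) := by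
  rw [Real.sin_sub, Real.sin_arctan, Real.cos_arctan]
  field_simp

theorem le_arctan_of_mul_cos_sub_sin_nonneg (hψ : ψ < Real.pi / 2)
    (h : -(Real.pi / 2) < ψ → 0 ≤ E * Real.cos ψ - Real.sin ψ) : ψ ≤ Real.arctan E := by
  rcases le_or_gt ψ (-(Real.pi / 2)) with h' | h'
  · exact h'.trans (Real.neg_pi_div_two_lt_arctan E).le
  · rw [← Real.arctan_tan h' hψ, Real.tan_eq_sin_div_cos]
    refine Real.arctan_mono ?_
    rw [div_le_iff₀ (Real.cos_pos_of_mem_Ioo ⟨h', hψ⟩)]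
    exact sub_nonneg.mp (h h')

theorem arctan_le_of_mul_cos_sub_sin_nonpos (hψ : -(Real.pi / 2) < ψ)
    (h : ψ < Real.pi / 2 → E * Real.cos ψ - Real.sin ψ ≤ 0) : Real.arctan E ≤ ψ := by
  have hneg : -ψ ≤ Real.arctan (-E) :=
    le_arctan_of_mul_cos_sub_sin_nonneg (by linarith) fun h' => by
      have := h (by linarith)
      rw [Real.cos_neg, Real.sin_neg]
      linarith
  rw [Real.arctan_neg] at hneg
  exact neg_le_neg_iff.mp hneg

theorem sin_le_mul_cos_sub_sin {β : ℝ} (hβ : 0 ≤ β) (hψ : -(Real.pi / 2) ≤ ψ)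
    (hβE : β ≤ Real.arctan E - ψ) : Real.sin β ≤ E * Real.cos ψ - Real.sin ψ := by
  rw [mul_cos_sub_sin_eq]
  have hsqrt : 1 ≤ √(1 + E ^ 2) := Real.one_le_sqrt.mpr (by nlinarith [sq_nonneg E])
  have hlt := Real.arctan_lt_pi_div_two E
  rcases le_total (Real.arctan E - ψ) (Real.pi / 2) with h | h
  · calc Real.sin β ≤ Real.sin (Real.arctan E - ψ) :=
          Real.sin_le_sin_of_le_of_le_pi_div_two (by linarith) h hβE
      _ ≤ √(1 + E ^ 2) * Real.sin (Real.arctan E - ψ) :=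
          le_mul_of_one_le_left
            (Real.sin_nonneg_of_nonneg_of_le_pi (hβ.trans hβE) (by linarith)) hsqrt
  · have hcos : Real.cos (Real.arctan E) ≤ Real.sin (Real.arctan E - ψ) := by
      rw [← Real.cos_sub_pi_div_two]
      exact Real.cos_le_cos_of_nonneg_of_le_pi (by linarith) (by linarith) (by linarith)
    calc Real.sin β ≤ √(1 + E ^ 2) * Real.cos (Real.arctan E) := by
          rw [Real.cos_arctan, mul_one_div_cancel (by positivity)]
          exact Real.sin_le_one β
      _ ≤ √(1 + E ^ 2) * Real.sin (Real.arctan E - ψ) := by gcongr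

end Angles

section Rotation

variable {ι : Type*} {A B A' B' : Matrix ι ι ℂ} {E χ : ℝ} {x : ι → ℂ}

/-- The first member of the pair `(A, B)` after the pair is rotated by the angle `ψ`: an
eigenangle `θ` lies above `ψ` exactly when the form of `rotatedMatrix A B ψ` is positive there. -/
noncomputable def rotatedMatrix (A B : Matrix ι ι ℂ) (ψ : ℝ) : Matrix ι ι ℂ :=
  (Real.cos ψ : ℂ) • A - (Real.sin ψ : ℂ) • B

theorem rotatedMatrix_isHermitian (hA : A.IsHermitian) (hB : B.IsHermitian) (ψ : ℝ) :
    (rotatedMatrix A B ψ).IsHermitian := by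
  have hreal (r : ℝ) : IsSelfAdjoint (r : ℂ) := Complex.conj_ofReal r
  exact (hA.smul (hreal _)).sub (hB.smul (hreal _))

variable [Fintype ι]

theorem quadForm_rotatedMatrix (A B : Matrix ι ι ℂ) (ψ : ℝ) (x : ι → ℂ) :
    quadForm (rotatedMatrix A B ψ) x = Real.cos ψ * quadForm A x - Real.sin ψ * quadForm B x := by
  rw [rotatedMatrix, quadForm_sub, quadForm_ofReal_smul, quadForm_ofReal_smul]

theorem IsPairEigenvector.rotated (h : IsPairEigenvector A B E x) (ψ : ℝ) :
    IsPairEigenvector (rotatedMatrix A B ψ) B (E * Real.cos ψ - Real.sin ψ) x := by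
  refine ⟨h.1, ?_⟩
  rw [rotatedMatrix, sub_mulVec, smul_mulVec, smul_mulVec, h.2, smul_smul, ← sub_smul]
  push_cast
  rw [mul_comm]

theorem abs_quadForm_rotatedMatrix_sub_le [DecidableEq ι]
    (hχ : √(‖A' - A‖ ^ 2 + ‖B' - B‖ ^ 2) ≤ χ) (ψ : ℝ) (y : ι → ℂ) :
    |quadForm (rotatedMatrix A' B' ψ) y - quadForm (rotatedMatrix A B ψ) y| ≤ χ * sqNorm y := by
  have hnorm : ‖rotatedMatrix A' B' ψ - rotatedMatrix A B ψ‖ ≤ χ :=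
    calc ‖rotatedMatrix A' B' ψ - rotatedMatrix A B ψ‖
        = ‖(Real.cos ψ : ℂ) • (A' - A) - (Real.sin ψ : ℂ) • (B' - B)‖ := by
          simp only [rotatedMatrix, smul_sub]; congr 1; abel
      _ ≤ |Real.cos ψ| * ‖A' - A‖ + |Real.sin ψ| * ‖B' - B‖ := by
          refine (norm_sub_le _ _).trans_eq ?_
          rw [norm_smul, norm_smul, Complex.norm_real, Complex.norm_real, Real.norm_eq_abs,
            Real.norm_eq_abs]
      _ ≤ √(|Real.cos ψ| ^ 2 + |Real.sin ψ| ^ 2) * √(‖A' - A‖ ^ 2 + ‖B' - B‖ ^ 2) := by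
          simpa using Real.sum_mul_le_sqrt_mul_sqrt Finset.univ
            ![|Real.cos ψ|, |Real.sin ψ|] ![‖A' - A‖, ‖B' - B‖]
      _ ≤ χ := by rwa [sq_abs, sq_abs, Real.cos_sq_add_sin_sq, Real.sqrt_one, one_mul]
  rw [← quadForm_sub]
  exact (abs_quadForm_le _ _).trans (by gcongr; exact sqNorm_nonneg y)

theorem IsPairEigenvector.eigenangleDist_eq (hA : A.IsHermitian) (hB : B.PosDef)
    (hx : IsPairEigenvector A B E x) : eigenangleDist A B x = √(1 + E ^ 2) * quadForm B x := by
  rw [eigenangleDist, add_mulVec, smul_mulVec, dotProduct_add, dotProduct_smul,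
    ← coe_quadForm hA, ← coe_quadForm hB.isHermitian, smul_eq_mul, mul_comm Complex.I,
    Complex.norm_add_mul_I, hx.quadForm_eq, mul_pow, ← add_one_mul, add_comm,
    Real.sqrt_mul (by positivity), Real.sqrt_sq (quadForm_pos hB hx.1).le]

theorem IsPairEigenvector.quadForm_le_eigenangleDist (hA : A.IsHermitian) (hB : B.PosDef)
    (hx : IsPairEigenvector A B E x) : quadForm B x ≤ eigenangleDist A B x := by
  rw [hx.eigenangleDist_eq hA hB]
  exact le_mul_of_one_le_left (quadForm_pos hB hx.1).le
    (Real.one_le_sqrt.mpr (by nlinarith [sq_nonneg E]))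

theorem IsPairEigenvector.quadForm_rotatedMatrix (hA : A.IsHermitian) (hB : B.PosDef)
    (hx : IsPairEigenvector A B E x) (ψ : ℝ) :
    quadForm (rotatedMatrix A B ψ) x =
      eigenangleDist A B x * Real.sin (Real.arctan E - ψ) := by
  rw [(hx.rotated ψ).quadForm_eq, mul_cos_sub_sin_eq, hx.eigenangleDist_eq hA hB]
  ring

end Rotation

section Perturbation

variable {ι : Type*} [Fintype ι] [DecidableEq ι] {A B A' B' : Matrix ι ι ℂ} {c χ ε F : ℝ}
  {x₀ : ι → ℂ}

theorem arctan_le_add_arcsin {E₀ : ℝ} (hA : A.IsHermitian) (hB : B.PosDef) (hB' : B'.PosDef)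
    (hχ : √(‖A' - A‖ ^ 2 + ‖B' - B‖ ^ 2) ≤ χ) (hx₀ : IsPairEigenvector A B E₀ x₀)
    (hx₀1 : sqNorm x₀ = 1) (hχd : χ ≤ eigenangleDist A B x₀)
    (hF : F * quadForm B' x₀ ≤ quadForm A' x₀) :
    Real.arctan F ≤ Real.arctan E₀ + Real.arcsin (χ / eigenangleDist A B x₀) := by
  have hχ0 : 0 ≤ χ := (Real.sqrt_nonneg _).trans hχ
  have hd : 0 < eigenangleDist A B x₀ :=
    (quadForm_pos hB hx₀.1).trans_le (hx₀.quadForm_le_eigenangleDist hA hB)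
  set d := eigenangleDist A B x₀
  set φ := Real.arcsin (χ / d)
  have hφ : 0 ≤ φ := Real.arcsin_nonneg.mpr (by positivity)
  have hsin : d * Real.sin φ = χ := by
    rw [Real.sin_arcsin (by linarith [div_nonneg hχ0 hd.le]) ((div_le_one hd).mpr hχd),
      mul_div_cancel₀ _ hd.ne']
  have hlow := Real.neg_pi_div_two_lt_arctan E₀
  refine arctan_le_of_mul_cos_sub_sin_nonpos (by linarith) fun hlt => ?_
  set ψ := Real.arctan E₀ + φ with hψ
  have hcos : 0 ≤ Real.cos ψ := Real.cos_nonneg_of_neg_pi_div_two_le_of_le (by linarith) hlt.le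
  have hx₀ψ : quadForm (rotatedMatrix A B ψ) x₀ = -χ := by
    rw [hx₀.quadForm_rotatedMatrix hA hB, hψ, sub_add_cancel_left, Real.sin_neg, mul_neg, hsin]
  have hpert := (abs_le.mp (abs_quadForm_rotatedMatrix_sub_le hχ ψ x₀)).2
  rw [hx₀ψ, hx₀1] at hpert
  refine nonpos_of_mul_nonpos_left ?_ (quadForm_pos hB' hx₀.1)
  calc (F * Real.cos ψ - Real.sin ψ) * quadForm B' x₀
      = Real.cos ψ * (F * quadForm B' x₀) - Real.sin ψ * quadForm B' x₀ := by ring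
    _ ≤ quadForm (rotatedMatrix A' B' ψ) x₀ := by rw [quadForm_rotatedMatrix]; gcongr
    _ ≤ 0 := by linarith

theorem sub_arcsin_le_arctan {m : ℕ} {E : Fin m → ℝ} {j₀ : Fin m} {w : ι → ℂ}
    (hA : A.IsHermitian) (hB : B.PosDef) (hB' : B'.PosDef) (hε : 0 < ε)
    (hBε : ∀ y, ε * sqNorm y ≤ quadForm B y) (hχ : √(‖A' - A‖ ^ 2 + ‖B' - B‖ ^ 2) ≤ χ)
    (x : Module.Basis (Fin m) ℂ (ι → ℂ)) (hx : ∀ j, IsPairEigenvector A B (E j) (x j))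
    (hx₀ : IsPairEigenvector A B (E j₀) x₀) (hx₀1 : sqNorm x₀ = 1)
    (hc : (min m 2 : ℕ) ≤ c) (hcχ : c * χ ≤ ε)
    (hgap : ∀ j, j ≠ j₀ → Real.arcsin (c * χ / ε) ≤ Real.arctan (E j) - Real.arctan (E j₀))
    (hw : IsPairEigenvector A' B' F w) :
    Real.arctan (E j₀) - Real.arcsin (c * χ / eigenangleDist A B x₀) ≤ Real.arctan F := by
  have hχ0 : 0 ≤ χ := (Real.sqrt_nonneg _).trans hχ
  have hs0 : 0 ≤ c * χ := mul_nonneg ((Nat.cast_nonneg _).trans hc) hχ0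
  have hsd : c * χ ≤ eigenangleDist A B x₀ := by
    have hBx₀ := hBε x₀
    rw [hx₀1, mul_one] at hBx₀
    exact hcχ.trans (hBx₀.trans (hx₀.quadForm_le_eigenangleDist hA hB))
  have hd : 0 < eigenangleDist A B x₀ :=
    (quadForm_pos hB hx₀.1).trans_le (hx₀.quadForm_le_eigenangleDist hA hB)
  set d := eigenangleDist A B x₀
  set φ := Real.arcsin (c * χ / d)
  have hφ : 0 ≤ φ := Real.arcsin_nonneg.mpr (by positivity)
  refine le_arctan_of_mul_cos_sub_sin_nonneg
    (by linarith [Real.arctan_lt_pi_div_two (E j₀)]) fun hlt => ?_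
  set ψ := Real.arctan (E j₀) - φ with hψ
  have hx₀ψ : (min m 2 : ℕ) * χ ≤ quadForm (rotatedMatrix A B ψ) x₀ := by
    rw [hx₀.quadForm_rotatedMatrix hA hB, hψ, sub_sub_cancel,
      Real.sin_arcsin (by linarith [div_nonneg hs0 hd.le]) ((div_le_one hd).mpr hsd),
      mul_div_cancel₀ _ hd.ne']
    gcongr
  have hgapψ : ∀ j, j ≠ j₀ → (min m 2 : ℕ) * χ / ε ≤ E j * Real.cos ψ - Real.sin ψ :=
    fun j hj =>
    calc (min m 2 : ℕ) * χ / ε ≤ c * χ / ε := by gcongr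
      _ = Real.sin (Real.arcsin (c * χ / ε)) := by
          rw [Real.sin_arcsin (by linarith [div_nonneg hs0 hε.le]) ((div_le_one hε).mpr hcχ)]
      _ ≤ E j * Real.cos ψ - Real.sin ψ :=
          sin_le_mul_cos_sub_sin (Real.arcsin_nonneg.mpr (by positivity)) hlt.le
            (by linarith [hgap j hj])
  have hrot := mul_sqNorm_le_quadForm (rotatedMatrix_isHermitian hA hB.isHermitian ψ) hB hε hχ0
    hBε x (fun j => (hx j).rotated ψ) (hx₀.rotated ψ) hx₀1 hx₀ψ hgapψ w
  have hpert := (abs_le.mp (abs_quadForm_rotatedMatrix_sub_le hχ ψ w)).1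
  rw [(hw.rotated ψ).quadForm_eq] at hpert
  exact nonneg_of_mul_nonneg_left (by linarith) (quadForm_pos hB' hw.1)

theorem abs_arctan_sub_arctan_le {m : ℕ} {E : Fin m → ℝ} {j₀ : Fin m} (hA : A.IsHermitian)
    (hB : B.PosDef) (hA' : A'.IsHermitian) (hB' : B'.PosDef) (hε : 0 < ε)
    (hBε : ∀ y, ε * sqNorm y ≤ quadForm B y) (hχ : √(‖A' - A‖ ^ 2 + ‖B' - B‖ ^ 2) ≤ χ)
    (x : Module.Basis (Fin m) ℂ (ι → ℂ)) (hx : ∀ j, IsPairEigenvector A B (E j) (x j))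
    (hx₀ : IsPairEigenvector A B (E j₀) x₀) (hx₀1 : sqNorm x₀ = 1)
    (hc : (min m 2 : ℕ) ≤ c) (hcχ : c * χ ≤ ε)
    (hgap : ∀ j, j ≠ j₀ → Real.arcsin (c * χ / ε) ≤ Real.arctan (E j) - Real.arctan (E j₀))
    (hF : IsLeast (pairEigenvalues A' B') F) :
    |Real.arctan (E j₀) - Real.arctan F| ≤ Real.arcsin (c * χ / eigenangleDist A B x₀) := by
  obtain ⟨w, hw⟩ := hF.1
  have hχ0 : 0 ≤ χ := (Real.sqrt_nonneg _).trans hχ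
  have hc1 : 1 ≤ c := by
    refine le_trans ?_ hc
    exact_mod_cast le_min (Nat.one_le_iff_ne_zero.mpr j₀.pos.ne') one_le_two
  have hχc : χ ≤ c * χ := le_mul_of_one_le_left hχ0 hc1
  have hd := hx₀.quadForm_le_eigenangleDist hA hB
  have hBx₀ := hBε x₀
  rw [hx₀1, mul_one] at hBx₀
  have hupper := arctan_le_add_arcsin hA hB hB' hχ hx₀ hx₀1 (by linarith)
    (mul_quadForm_le_of_mem_lowerBounds hA' hB' hF.2 x₀)
  have hlower := sub_arcsin_le_arctan hA hB hB' hε hBε hχ x hx hx₀ hx₀1 hc hcχ hgap hw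
  have hmono : Real.arcsin (χ / eigenangleDist A B x₀) ≤
      Real.arcsin (c * χ / eigenangleDist A B x₀) :=
    Real.monotone_arcsin (by gcongr; exact norm_nonneg _)
  rw [abs_sub_le_iff]
  constructor <;> linarith

end Perturbation

section MatrixNorms

variable {ι κ τ : Type*} [Fintype ι] [Fintype κ]

theorem sqNorm_mulVec_of_conjTranspose_mul_self [DecidableEq κ] {C : Matrix ι κ ℂ}
    (h : Cᴴ * C = 1) (x : κ → ℂ) : sqNorm (C *ᵥ x) = sqNorm x := by
  have : star (C *ᵥ x) ⬝ᵥ (C *ᵥ x) = star x ⬝ᵥ x := by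
    rw [star_mulVec, ← dotProduct_mulVec, mulVec_mulVec, h, one_mulVec]
  rw [star_dotProduct_self, star_dotProduct_self] at this
  exact_mod_cast this

theorem norm_le_one_of_conjTranspose_mul_self [DecidableEq κ] {C : Matrix ι κ ℂ}
    (h : Cᴴ * C = 1) : ‖C‖ ≤ 1 := by
  rw [l2_opNorm_def]
  refine ContinuousLinearMap.opNorm_le_bound _ zero_le_one fun x => ?_
  have hx := sqNorm_mulVec_of_conjTranspose_mul_self h x.ofLp
  rw [sqNorm_eq_norm_sq, sqNorm_eq_norm_sq] at hx
  rw [one_mul]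
  exact ((sq_eq_sq₀ (norm_nonneg _) (norm_nonneg _)).mp hx).le

theorem norm_conjTranspose_mul_le_one [DecidableEq κ] [Fintype τ] [DecidableEq τ]
    {C : Matrix ι κ ℂ} {D : Matrix ι τ ℂ} (hC : Cᴴ * C = 1) (hD : Dᴴ * D = 1) :
    ‖Cᴴ * D‖ ≤ 1 := by
  classical
  refine (l2_opNorm_mul _ _).trans ?_
  rw [l2_opNorm_conjTranspose]
  exact mul_le_one₀ (norm_le_one_of_conjTranspose_mul_self hC) (norm_nonneg _)
    (norm_le_one_of_conjTranspose_mul_self hD)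

theorem norm_conjTranspose_mul_mul_le [DecidableEq ι] [DecidableEq κ] [Fintype τ]
    [DecidableEq τ] {C : Matrix ι κ ℂ} {D : Matrix ι τ ℂ} (hC : ‖C‖ ≤ 1) (hD : ‖D‖ ≤ 1)
    (M : Matrix ι ι ℂ) : ‖Cᴴ * M * D‖ ≤ ‖M‖ := by
  calc ‖Cᴴ * M * D‖ ≤ ‖Cᴴ‖ * ‖M‖ * ‖D‖ :=
        (l2_opNorm_mul _ _).trans (by gcongr; exact l2_opNorm_mul _ _)
    _ ≤ 1 * ‖M‖ * 1 := by rw [l2_opNorm_conjTranspose]; gcongr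
    _ = ‖M‖ := by ring

theorem norm_le_card_mul_of_entry_le [DecidableEq ι] (M : Matrix ι ι ℂ) {c : ℝ} (hc : 0 ≤ c)
    (h : ∀ i j, ‖M i j‖ ≤ c) : ‖M‖ ≤ Fintype.card ι * c := by
  rw [l2_opNorm_def]
  refine ContinuousLinearMap.opNorm_le_bound _ (by positivity) fun x => ?_
  refine (sq_le_sq₀ (norm_nonneg _) (by positivity)).mp ?_
  have hentry (i : ι) : ‖(M *ᵥ x) i‖ ^ 2 ≤ Fintype.card ι * (c ^ 2 * ‖x‖ ^ 2) :=
    calc ‖(M *ᵥ x) i‖ ^ 2 ≤ (∑ j, c * ‖x j‖) ^ 2 := by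
          gcongr
          refine (norm_sum_le _ _).trans (Finset.sum_le_sum fun j _ => ?_)
          rw [norm_mul]
          gcongr
          exact h i j
      _ ≤ Fintype.card ι * ∑ j, (c * ‖x j‖) ^ 2 := sq_sum_le_card_mul_sum_sq
      _ = Fintype.card ι * (c ^ 2 * ‖x‖ ^ 2) := by
          simp only [EuclideanSpace.norm_sq_eq, mul_pow, Finset.mul_sum]
  calc _ = ∑ i, ‖(M *ᵥ x) i‖ ^ 2 := EuclideanSpace.norm_sq_eq _
    _ ≤ ∑ _i : ι, Fintype.card ι * (c ^ 2 * ‖x‖ ^ 2) := Finset.sum_le_sum fun i _ => hentry i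
    _ = (Fintype.card ι * c * ‖x‖) ^ 2 := by
        rw [Finset.sum_const, Finset.card_univ, nsmul_eq_mul]; ring

theorem exists_inverse_of_injective [DecidableEq ι] [DecidableEq κ] {W : Matrix ι κ ℂ}
    (hW : Function.Injective W.mulVec) (hW' : Function.Injective Wᴴ.mulVec) :
    ∃ W' : Matrix κ ι ℂ, W * W' = 1 ∧ W' * W = 1 := by
  have hunit : IsUnit (W * Wᴴ) := by
    have := (PosDef.conjTranspose_mul_self Wᴴ hW').isUnit
    rwa [conjTranspose_conjTranspose] at this
  have hright : W * (Wᴴ * (W * Wᴴ)⁻¹) = 1 := by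
    rw [← Matrix.mul_assoc, mul_nonsing_inv _ ((isUnit_iff_isUnit_det _).mp hunit)]
  refine ⟨Wᴴ * (W * Wᴴ)⁻¹, hright, Matrix.toLin'.injective (LinearMap.ext fun v => hW ?_)⟩
  rw [toLin'_apply, mulVec_mulVec, ← Matrix.mul_assoc, hright, Matrix.one_mul, toLin'_one,
    LinearMap.id_apply]

end MatrixNorms

section RowNorm

variable {ι κ τ : Type*} [Fintype κ]

/-- The Euclidean norm of the `i`-th row of `M`. -/
noncomputable def rowNorm (M : Matrix ι κ ℂ) (i : ι) : ℝ := √(sqNorm (M i))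

theorem rowNorm_nonneg (M : Matrix ι κ ℂ) (i : ι) : 0 ≤ rowNorm M i := Real.sqrt_nonneg _

theorem rowNorm_le_norm [Fintype ι] [DecidableEq κ] (M : Matrix ι κ ℂ) (i : ι) :
    rowNorm M i ≤ ‖M‖ := by
  classical
  have h := Mᴴ.l2_opNorm_mulVec (EuclideanSpace.single i 1)
  rw [l2_opNorm_conjTranspose, PiLp.norm_single, norm_one, mul_one] at h
  refine Eq.trans_le ?_ h
  simp [rowNorm, sqNorm, EuclideanSpace.norm_eq]

theorem norm_mul_conjTranspose_apply_le (M : Matrix ι κ ℂ) (i j : ι) :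
    ‖(M * Mᴴ) i j‖ ≤ rowNorm M i * rowNorm M j :=
  calc ‖(M * Mᴴ) i j‖ ≤ ∑ k, ‖M i k‖ * ‖M j k‖ := by
        refine (norm_sum_le _ _).trans_eq (Finset.sum_congr rfl fun k _ => ?_)
        change ‖M i k * star (M j k)‖ = _
        rw [norm_mul, norm_star]
    _ ≤ rowNorm M i * rowNorm M j := Real.sum_mul_le_sqrt_mul_sqrt _ _ _

theorem mul_rowNorm_le_rowNorm {M : Matrix ι κ ℂ} {N : Matrix τ κ ℂ} {i : ι} {j : τ} {c : ℝ}
    (hc : 0 ≤ c) (h : ∀ k, c * ‖M i k‖ ≤ ‖N j k‖) : c * rowNorm M i ≤ rowNorm N j := by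
  rw [rowNorm, ← Real.sqrt_sq hc, ← Real.sqrt_mul (sq_nonneg c), sqNorm, Finset.mul_sum]
  refine Real.sqrt_le_sqrt (Finset.sum_le_sum fun k _ => ?_)
  rw [← mul_pow]
  gcongr
  exact h k

end RowNorm

section Eigendecomposition

theorem star_col_dotProduct_mulVec_col {ι κ : Type*} [Fintype ι] (K : Matrix ι ι ℂ)
    (V : Matrix ι κ ℂ) (i j : κ) :
    star (V.col i) ⬝ᵥ (K *ᵥ V.col j) = (Vᴴ * K * V) i j := by
  rw [Matrix.mul_assoc]
  rfl

variable {n : ℕ} {S V : Matrix (Fin n) (Fin n) ℂ} {lam : Fin n → ℝ} {ε : ℝ}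

/-- The columns of `V` that belong to eigenvalues at most `ε`. -/
def discardedColumns (V : Matrix (Fin n) (Fin n) ℂ) (lam : Fin n → ℝ) (ε : ℝ) :
    Matrix (Fin n) {i : Fin n // ¬ ε < lam i} ℂ :=
  V.submatrix id Subtype.val

theorem thresholded_eq_submatrix (M V : Matrix (Fin n) (Fin n) ℂ) (lam : Fin n → ℝ) (ε : ℝ) :
    thresholded M V lam ε = (Vᴴ * M * V).submatrix Subtype.val Subtype.val := rfl

theorem thresholded_add (M N V : Matrix (Fin n) (Fin n) ℂ) (lam : Fin n → ℝ) (ε : ℝ) :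
    thresholded (M + N) V lam ε = thresholded M V lam ε + thresholded N V lam ε := by
  simp only [thresholded, Matrix.mul_add, Matrix.add_mul]

theorem thresholded_isHermitian {M : Matrix (Fin n) (Fin n) ℂ} (hM : M.IsHermitian)
    (V : Matrix (Fin n) (Fin n) ℂ) (lam : Fin n → ℝ) (ε : ℝ) :
    (thresholded M V lam ε).IsHermitian :=
  isHermitian_conjTranspose_mul_mul _ hM

namespace IsEigendecomposition

theorem conjTranspose_mul_self (h : IsEigendecomposition S V lam) : Vᴴ * V = 1 :=
  mem_unitaryGroup_iff'.mp h.unitary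

theorem self_mul_conjTranspose (h : IsEigendecomposition S V lam) : V * Vᴴ = 1 :=
  mem_unitaryGroup_iff.mp h.unitary

theorem conjTranspose_mul_mul (h : IsEigendecomposition S V lam) :
    Vᴴ * S * V = diagonal fun i => (lam i : ℂ) := by
  rw [Matrix.mul_assoc, h.eigen, ← Matrix.mul_assoc, h.conjTranspose_mul_self, Matrix.one_mul]

theorem conjTranspose_mul_eq (h : IsEigendecomposition S V lam) :
    Vᴴ * S = (diagonal fun i => (lam i : ℂ)) * Vᴴ := by
  rw [← h.conjTranspose_mul_mul, Matrix.mul_assoc (Vᴴ * S), h.self_mul_conjTranspose,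
    Matrix.mul_one]

theorem keptColumns_isometry (h : IsEigendecomposition S V lam) :
    (keptColumns V lam ε)ᴴ * keptColumns V lam ε = 1 := by
  change (Vᴴ * V).submatrix Subtype.val Subtype.val = 1
  rw [h.conjTranspose_mul_self, submatrix_one _ Subtype.val_injective]

theorem discardedColumns_isometry (h : IsEigendecomposition S V lam) :
    (discardedColumns V lam ε)ᴴ * discardedColumns V lam ε = 1 := by
  change (Vᴴ * V).submatrix Subtype.val Subtype.val = 1
  rw [h.conjTranspose_mul_self, submatrix_one _ Subtype.val_injective]

theorem keptColumns_mul_add_discardedColumns_mul (h : IsEigendecomposition S V lam) :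
    keptColumns V lam ε * (keptColumns V lam ε)ᴴ +
      discardedColumns V lam ε * (discardedColumns V lam ε)ᴴ = 1 := by
  rw [← h.self_mul_conjTranspose]
  ext i j
  exact Fintype.sum_subtype_add_sum_subtype (fun k => ε < lam k) fun k => V i k * star (V j k)

theorem mul_discardedColumns (h : IsEigendecomposition S V lam) :
    S * discardedColumns V lam ε = discardedColumns V lam ε *
      diagonal fun i : {i : Fin n // ¬ ε < lam i} => (lam i : ℂ) := by
  ext i j
  have hij : (S * V) i j = (V * diagonal fun i => (lam i : ℂ)) i j := by rw [h.eigen]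
  rw [mul_diagonal] at hij ⊢
  exact hij

theorem thresholded_eq (h : IsEigendecomposition S V lam) :
    thresholded S V lam ε = diagonal fun i : Kept lam ε => (lam i : ℂ) := by
  rw [thresholded_eq_submatrix, h.conjTranspose_mul_mul,
    submatrix_diagonal _ _ Subtype.val_injective]
  rfl

theorem quadForm_keptColumns (h : IsEigendecomposition S V lam) (y : Kept lam ε → ℂ) :
    quadForm S (keptColumns V lam ε *ᵥ y) = ∑ i : Kept lam ε, lam i * ‖y i‖ ^ 2 := by
  rw [← quadForm_conjTranspose_mul_mul, ← quadForm_diagonal (fun i : Kept lam ε => lam i),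
    ← h.thresholded_eq, thresholded]

theorem thresholded_posDef (h : IsEigendecomposition S V lam) (hε : 0 < ε) :
    (thresholded S V lam ε).PosDef := by
  rw [h.thresholded_eq, posDef_diagonal_iff]
  exact fun i => by exact_mod_cast hε.trans i.2

theorem mul_sqNorm_le_quadForm_thresholded (h : IsEigendecomposition S V lam)
    (y : Kept lam ε → ℂ) : ε * sqNorm y ≤ quadForm (thresholded S V lam ε) y := by
  rw [h.thresholded_eq, quadForm_diagonal (fun i : Kept lam ε => lam i), sqNorm, Finset.mul_sum]
  refine Finset.sum_le_sum fun i _ => ?_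
  gcongr
  exact i.2.le

theorem quadForm_le_of_orthogonal (h : IsEigendecomposition S V lam) {b : ℝ}
    (hb : ∀ i, ¬ ε < lam i → lam i ≤ b) {x : Fin n → ℂ}
    (hx : (keptColumns V lam ε)ᴴ *ᵥ x = 0) : quadForm S x ≤ b * sqNorm x := by
  set u := (discardedColumns V lam ε)ᴴ *ᵥ x
  have hxu : x = discardedColumns V lam ε *ᵥ u := by
    rw [← one_mulVec x, ← h.keptColumns_mul_add_discardedColumns_mul (ε := ε), add_mulVec,
      ← mulVec_mulVec, hx, mulVec_zero, zero_add, ← mulVec_mulVec]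
  have hdiag : (discardedColumns V lam ε)ᴴ * S * discardedColumns V lam ε =
      diagonal fun i : {i : Fin n // ¬ ε < lam i} => (lam i : ℂ) := by
    rw [Matrix.mul_assoc, h.mul_discardedColumns, ← Matrix.mul_assoc,
      h.discardedColumns_isometry, Matrix.one_mul]
  rw [hxu, sqNorm_mulVec_of_conjTranspose_mul_self h.discardedColumns_isometry,
    ← quadForm_conjTranspose_mul_mul, hdiag,
    quadForm_diagonal (fun i : {i : Fin n // ¬ ε < lam i} => lam i), sqNorm, Finset.mul_sum]
  refine Finset.sum_le_sum fun i _ => ?_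
  gcongr
  exact hb i i.2

theorem eigenvalue_nonneg (h : IsEigendecomposition S V lam) (hS : S.PosSemidef) (i : Fin n) :
    0 ≤ lam i := by
  have hdiag := (hS.conjTranspose_mul_mul_same V).diag_nonneg (i := i)
  rw [h.conjTranspose_mul_mul, diagonal_apply_eq] at hdiag
  exact_mod_cast hdiag

theorem eigenvalue_le_norm (h : IsEigendecomposition S V lam) (i : Fin n) : lam i ≤ ‖S‖ := by
  have hV := norm_le_one_of_conjTranspose_mul_self h.conjTranspose_mul_self
  calc lam i ≤ ‖(lam i : ℂ)‖ := by rw [Complex.norm_real]; exact le_abs_self _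
    _ ≤ ‖fun i => (lam i : ℂ)‖ := norm_le_pi_norm (fun i => (lam i : ℂ)) i
    _ = ‖Vᴴ * S * V‖ := by rw [h.conjTranspose_mul_mul, l2_opNorm_diagonal]
    _ ≤ ‖S‖ := norm_conjTranspose_mul_mul_le hV hV S

theorem geometricMeanBound (h : IsEigendecomposition S V lam) (hS : S.PosSemidef) (α : ℝ) :
    GeometricMeanBound S V lam 1 α := by
  intro i j
  have hlam := h.eigenvalue_nonneg hS
  rw [star_col_dotProduct_mulVec_col, h.conjTranspose_mul_mul, one_mul]
  rcases eq_or_ne i j with rfl | hij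
  · rw [diagonal_apply_eq, min_self, max_self, Complex.norm_real, Real.norm_of_nonneg (hlam i)]
    rcases (hlam i).eq_or_lt with hzero | hpos
    · rw [← hzero]
      positivity
    · rw [← Real.rpow_add hpos, sub_add_cancel, Real.rpow_one]
  · rw [diagonal_apply_ne _ hij, norm_zero]
    exact mul_nonneg (Real.rpow_nonneg (le_min (hlam i) (hlam j)) _)
      (Real.rpow_nonneg ((hlam i).trans (le_max_left _ _)) _)

end IsEigendecomposition

end Eigendecomposition

section Overlap

variable {n m : ℕ} {S T V U : Matrix (Fin n) (Fin n) ℂ} {lam ν : Fin n → ℝ} {η ε ρ : ℝ}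

theorem SpectralGap.le_of_kept (hgap : SpectralGap lam m η ε ρ) (hlam : Antitone lam)
    (hη : 0 ≤ η) {i : Fin n} (hi : ε < lam i) : (1 + ρ) * ε ≤ lam i := by
  obtain ⟨hm, hmn, hlow, -, hhigh⟩ := hgap
  have him : i.val < m := by
    by_contra! hmi
    have hle := hlow ⟨m, hmi.trans_lt i.2⟩ rfl
    have : lam i ≤ lam ⟨m, hmi.trans_lt i.2⟩ := hlam hmi
    linarith
  exact (hhigh ⟨m - 1, by omega⟩ (by simp only; omega)).trans
    (hlam (show i.val ≤ m - 1 by omega))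

theorem SpectralGap.add_le_of_discarded (hgap : SpectralGap lam m η ε ρ)
    (hlam : Antitone lam) {i : Fin n} (hi : ¬ ε < lam i) : lam i + η ≤ ε := by
  obtain ⟨hm, hmn, hlow, hlt, hhigh⟩ := hgap
  have hmi : m ≤ i.val := by
    by_contra! him
    have hge := hhigh ⟨m - 1, by omega⟩ (by simp only; omega)
    have : lam ⟨m - 1, by omega⟩ ≤ lam i := hlam (show i.val ≤ m - 1 by omega)
    linarith
  have hle := hlow ⟨m, hmi.trans_lt i.2⟩ rfl
  have : lam i ≤ lam ⟨m, hmi.trans_lt i.2⟩ := hlam hmi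
  linarith

theorem SpectralGap.nonempty_kept (hgap : SpectralGap lam m η ε ρ) : Nonempty (Kept lam ε) := by
  obtain ⟨hm, hmn, -, hlt, hhigh⟩ := hgap
  exact ⟨⟨⟨m - 1, by omega⟩, hlt.trans_le (hhigh _ (by simp only; omega))⟩⟩

/-- The matrix of the projection from the span of the kept columns of `V` to the span of the kept
columns of `U`. -/
noncomputable def overlap (V U : Matrix (Fin n) (Fin n) ℂ) (lam ν : Fin n → ℝ) (ε : ℝ) :
    Matrix (Kept ν ε) (Kept lam ε) ℂ :=
  (keptColumns U ν ε)ᴴ * keptColumns V lam ε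

theorem conjTranspose_overlap (V U : Matrix (Fin n) (Fin n) ℂ) (lam ν : Fin n → ℝ) (ε : ℝ) :
    (overlap V U lam ν ε)ᴴ = overlap U V ν lam ε := by
  rw [overlap, overlap, conjTranspose_mul, conjTranspose_conjTranspose]

theorem overlap_mulVec_injective (hV : IsEigendecomposition S V lam)
    (hU : IsEigendecomposition T U ν) {b : ℝ} (hb : ∀ i, ¬ ε < ν i → ν i ≤ b)
    (hgap : ∀ i, ε < lam i → b + ‖T - S‖ < lam i) :
    Function.Injective (overlap V U lam ν ε).mulVec := by
  refine (injective_iff_map_eq_zero (overlap V U lam ν ε).mulVecLin).mpr fun y hy => ?_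
  rw [mulVecLin_apply, overlap, ← mulVec_mulVec] at hy
  set x := keptColumns V lam ε *ᵥ y with hx
  have hform : ∑ i : Kept lam ε, lam i * ‖y i‖ ^ 2 ≤ (b + ‖T - S‖) * sqNorm y := by
    have hpert := (abs_le.mp (abs_quadForm_le (T - S) x)).1
    have hU := hU.quadForm_le_of_orthogonal hb hy
    rw [quadForm_sub] at hpert
    rw [← hV.quadForm_keptColumns, ← hx,
      ← sqNorm_mulVec_of_conjTranspose_mul_self (hV.keptColumns_isometry (ε := ε)) y, ← hx]
    linarith
  rw [sqNorm, Finset.mul_sum, ← sub_nonpos, ← Finset.sum_sub_distrib] at hform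
  have hterm (i : Kept lam ε) : 0 ≤ lam i * ‖y i‖ ^ 2 - (b + ‖T - S‖) * ‖y i‖ ^ 2 := by
    rw [← sub_mul]
    exact mul_nonneg (sub_nonneg.mpr (hgap i i.2).le) (sq_nonneg _)
  have hzero := (Finset.sum_eq_zero_iff_of_nonneg fun i _ => hterm i).mp
    (hform.antisymm (Finset.sum_nonneg fun i _ => hterm i))
  ext i
  have hi := hzero i (Finset.mem_univ i)
  rw [← sub_mul, mul_eq_zero] at hi
  simpa using hi.resolve_left (sub_pos.mpr (hgap i i.2)).ne'

theorem starCongruent_overlap (hV : IsEigendecomposition S V lam)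
    (hU : IsEigendecomposition T U ν) (hε : 0 < ε) (hρ : 0 < ρ)
    (hgap : SpectralGap lam m ‖T - S‖ ε ρ) (hnoise : (1 + ρ⁻¹) * ‖T - S‖ ≤ ε)
    (A B : Matrix (Kept ν ε) (Kept ν ε) ℂ) :
    StarCongruent A B ((overlap V U lam ν ε)ᴴ * A * overlap V U lam ν ε)
      ((overlap V U lam ν ε)ᴴ * B * overlap V U lam ν ε) := by
  have hsmall : ‖T - S‖ < ρ * ε := by
    have : (1 + ρ) * ‖T - S‖ ≤ ρ * ε :=
      calc (1 + ρ) * ‖T - S‖ = ρ * ((1 + ρ⁻¹) * ‖T - S‖) := by field_simp; ring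
        _ ≤ ρ * ε := by gcongr
    rcases (norm_nonneg (T - S)).eq_or_lt with hzero | hpos
    · rw [← hzero]
      positivity
    · exact (lt_mul_of_one_lt_left hpos (by linarith)).trans_le this
  have hinj : Function.Injective (overlap V U lam ν ε).mulVec :=
    overlap_mulVec_injective hV hU (fun _ => not_lt.mp) fun i hi => by
      linarith [hgap.le_of_kept hV.antitone (norm_nonneg _) hi]
  have hinj' : Function.Injective (overlap V U lam ν ε)ᴴ.mulVec := by
    rw [conjTranspose_overlap]
    refine overlap_mulVec_injective hU hV (b := ε - ‖T - S‖)
      (fun i hi => le_sub_iff_add_le.mpr (hgap.add_le_of_discarded hV.antitone hi)) fun i hi => ?_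
    rwa [norm_sub_rev, sub_add_cancel]
  obtain ⟨W', hWW', hW'W⟩ := exists_inverse_of_injective hinj hinj'
  exact ⟨_, W', hWW', hW'W, rfl, rfl⟩

end Overlap

section Leakage

variable {n m : ℕ} {S T V U : Matrix (Fin n) (Fin n) ℂ} {lam ν : Fin n → ℝ} {ε ρ : ℝ}

/-- The norm of the component of the `i`-th column of `V` that is lost when it is projected to
the span of the kept columns of `U`. -/
noncomputable def leakage (V U : Matrix (Fin n) (Fin n) ℂ) (ν : Fin n → ℝ) (ε : ℝ) (i : Fin n) :
    ℝ :=
  rowNorm (Vᴴ * discardedColumns U ν ε) i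

theorem leakage_nonneg (V U : Matrix (Fin n) (Fin n) ℂ) (ν : Fin n → ℝ) (ε : ℝ) (i : Fin n) :
    0 ≤ leakage V U ν ε i :=
  rowNorm_nonneg _ i

theorem leakage_le_one (hV : IsEigendecomposition S V lam) (hU : IsEigendecomposition T U ν)
    (i : Fin n) : leakage V U ν ε i ≤ 1 :=
  (rowNorm_le_norm _ i).trans
    (norm_conjTranspose_mul_le_one hV.conjTranspose_mul_self hU.discardedColumns_isometry)

theorem sub_mul_leakage_le (hV : IsEigendecomposition S V lam)
    (hU : IsEigendecomposition T U ν) {i : Fin n} (hi : ε ≤ lam i) :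
    (lam i - ε) * leakage V U ν ε i ≤ ‖T - S‖ := by
  set D := discardedColumns U ν ε
  have hsylvester : Vᴴ * (T - S) * D =
      Vᴴ * D * diagonal (fun k : {k : Fin n // ¬ ε < ν k} => (ν k : ℂ)) -
        diagonal (fun i => (lam i : ℂ)) * (Vᴴ * D) := by
    rw [Matrix.mul_sub, Matrix.sub_mul, hV.conjTranspose_mul_eq, Matrix.mul_assoc Vᴴ T,
      hU.mul_discardedColumns, Matrix.mul_assoc, Matrix.mul_assoc]
  refine (mul_rowNorm_le_rowNorm (N := Vᴴ * (T - S) * D) (j := i) (sub_nonneg.mpr hi)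
    fun k => ?_).trans ((rowNorm_le_norm _ i).trans (norm_conjTranspose_mul_mul_le
      (norm_le_one_of_conjTranspose_mul_self hV.conjTranspose_mul_self)
      (norm_le_one_of_conjTranspose_mul_self hU.discardedColumns_isometry) _))
  have hentry : (Vᴴ * (T - S) * D) i k = ((ν k - lam i : ℝ) : ℂ) * (Vᴴ * D) i k := by
    rw [hsylvester, Matrix.sub_apply, mul_diagonal, diagonal_mul]
    push_cast
    ring
  rw [hentry, norm_mul, Complex.norm_real, Real.norm_eq_abs, abs_sub_comm]
  gcongr
  exact (sub_le_sub_left (not_lt.mp k.2) _).trans (le_abs_self _)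

theorem leakage_mul_le (hV : IsEigendecomposition S V lam) (hU : IsEigendecomposition T U ν)
    (hε : 0 < ε) (hρ : 0 < ρ) {i : Fin n} (hi : (1 + ρ) * ε ≤ lam i) :
    leakage V U ν ε i * lam i ≤ (1 + ρ⁻¹) * ‖T - S‖ := by
  have hεi : ε ≤ lam i := (le_mul_of_one_le_left hε.le (by linarith)).trans hi
  have hlam : lam i ≤ (1 + ρ⁻¹) * (lam i - ε) := by
    have : (1 + ρ⁻¹) * (lam i - ε) - lam i = ρ⁻¹ * (lam i - (1 + ρ) * ε) := by
      field_simp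
      ring
    have := mul_nonneg (inv_pos.mpr hρ).le (sub_nonneg.mpr hi)
    linarith
  calc leakage V U ν ε i * lam i ≤ leakage V U ν ε i * ((1 + ρ⁻¹) * (lam i - ε)) :=
        mul_le_mul_of_nonneg_left hlam (leakage_nonneg V U ν ε i)
    _ = (1 + ρ⁻¹) * ((lam i - ε) * leakage V U ν ε i) := by ring
    _ ≤ (1 + ρ⁻¹) * ‖T - S‖ := by gcongr; exact sub_mul_leakage_le hV hU hεi

theorem SpectralGap.leakage_mul_le_noise (hgap : SpectralGap lam m ‖T - S‖ ε ρ)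
    (hV : IsEigendecomposition S V lam) (hU : IsEigendecomposition T U ν) (hε : 0 < ε)
    (hρ : 0 < ρ) {i : Fin n} (hi : ε < lam i) :
    leakage V U ν ε i * lam i ≤ (1 + ρ⁻¹) * ‖T - S‖ :=
  leakage_mul_le hV hU hε hρ (hgap.le_of_kept hV.antitone (norm_nonneg _) hi)

theorem SpectralGap.leakage_mul_le_threshold (hgap : SpectralGap lam m ‖T - S‖ ε ρ)
    (hS : S.PosSemidef) (hV : IsEigendecomposition S V lam) (hU : IsEigendecomposition T U ν)
    (hε : 0 < ε) (hρ : 0 < ρ) (hnoise : (1 + ρ⁻¹) * ‖T - S‖ ≤ ε) (i : Fin n) :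
    leakage V U ν ε i * lam i ≤ ε := by
  by_cases hi : ε < lam i
  · exact (hgap.leakage_mul_le_noise hV hU hε hρ hi).trans hnoise
  · exact (mul_le_of_le_one_left (hV.eigenvalue_nonneg hS i) (leakage_le_one hV hU i)).trans
      (not_lt.mp hi)

theorem mul_geometricMean_le {l a b L α : ℝ} (hl : 0 ≤ l) (hl1 : l ≤ 1) (ha : 0 ≤ a)
    (hb : 0 ≤ b) (haL : a ≤ L) (hbL : b ≤ L) (hε : 0 < ε) (hla : l * a ≤ ε) (hα : 0 ≤ α)
    (hα1 : α ≤ 1) : l * (min a b ^ (1 - α) * max a b ^ α) ≤ ε * (L / ε) ^ α := by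
  have : 0 ≤ 1 - α := sub_nonneg.mpr hα1
  have hL : 0 ≤ L := ha.trans haL
  calc l * (min a b ^ (1 - α) * max a b ^ α)
      ≤ l ^ (1 - α) * (a ^ (1 - α) * L ^ α) := by
        gcongr
        · exact Real.self_le_rpow_of_le_one hl hl1 (sub_le_self 1 hα)
        · exact min_le_left _ _
        · exact max_le haL hbL
    _ = (l * a) ^ (1 - α) * L ^ α := by rw [Real.mul_rpow hl ha, mul_assoc]
    _ ≤ ε ^ (1 - α) * L ^ α := by gcongr
    _ = ε * (L / ε) ^ α := by
        rw [Real.div_rpow hL hε.le, Real.rpow_sub hε, Real.rpow_one]; ring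

theorem GeometricMeanBound.leakage_mul_max_norm_le {K : Matrix (Fin n) (Fin n) ℂ} {μ α : ℝ}
    (h : GeometricMeanBound K V lam μ α) (hS : S.PosSemidef) (hV : IsEigendecomposition S V lam)
    (hU : IsEigendecomposition T U ν) (hε : 0 < ε) (hμ : 0 ≤ μ) (hα : 0 ≤ α) (hα1 : α ≤ 1)
    (hleak : ∀ i, leakage V U ν ε i * lam i ≤ ε) (k j : Fin n) :
    leakage V U ν ε k * max ‖(Vᴴ * K * V) k j‖ ‖(Vᴴ * K * V) j k‖ ≤
      μ * (ε * (‖S‖ / ε) ^ α) := by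
  have hlam := hV.eigenvalue_nonneg hS
  have hentry (i j : Fin n) : ‖(Vᴴ * K * V) i j‖ ≤
      μ * (min (lam i) (lam j) ^ (1 - α) * max (lam i) (lam j) ^ α) := by
    rw [← star_col_dotProduct_mulVec_col, ← mul_assoc]
    exact h i j
  have hmax : max ‖(Vᴴ * K * V) k j‖ ‖(Vᴴ * K * V) j k‖ ≤
      μ * (min (lam k) (lam j) ^ (1 - α) * max (lam k) (lam j) ^ α) :=
    max_le (hentry k j) (by rw [min_comm, max_comm (lam k)]; exact hentry j k)
  calc _ ≤ leakage V U ν ε k * (μ * (min (lam k) (lam j) ^ (1 - α) *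
          max (lam k) (lam j) ^ α)) :=
        mul_le_mul_of_nonneg_left hmax (leakage_nonneg V U ν ε k)
    _ = μ * (leakage V U ν ε k * (min (lam k) (lam j) ^ (1 - α) *
          max (lam k) (lam j) ^ α)) := by ring
    _ ≤ μ * (ε * (‖S‖ / ε) ^ α) :=
        mul_le_mul_of_nonneg_left (mul_geometricMean_le (leakage_nonneg V U ν ε k)
          (leakage_le_one hV hU k) (hlam k) (hlam j) (hV.eigenvalue_le_norm k)
          (hV.eigenvalue_le_norm j) hε (hleak k) hα hα1) hμ

end Leakage

section EntryBounds

variable {ι κ τ : Type*} [Fintype κ]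

theorem norm_mul_apply_le {M : Matrix ι κ ℂ} {N : Matrix κ τ ℂ} {i : ι} {j : τ} {r : ℝ}
    (h : ∀ k, ‖M i k‖ * ‖N k j‖ ≤ r) : ‖(M * N) i j‖ ≤ Fintype.card κ * r := by
  calc ‖(M * N) i j‖ ≤ ∑ k, ‖M i k‖ * ‖N k j‖ :=
        (norm_sum_le _ _).trans_eq (Finset.sum_congr rfl fun k _ => norm_mul _ _)
    _ ≤ Fintype.card κ * r := by
        rw [← nsmul_eq_mul]
        exact Finset.sum_le_card_nsmul _ _ _ fun k _ => h k

theorem norm_one_sub_mul_mul_one_sub_sub_apply_le [DecidableEq κ] {q h : Matrix κ κ ℂ}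
    {l : κ → ℝ} {t r : ℝ} (hl : ∀ i, 0 ≤ l i) (hl1 : ∀ i, l i ≤ 1)
    (hq : ∀ i j, ‖q i j‖ ≤ l i * l j) (hh : ∀ k j, l k * max ‖h k j‖ ‖h j k‖ ≤ t) {i j : κ}
    (hi : l i * t ≤ r) (hj : l j * t ≤ r) :
    ‖((1 - q) * h * (1 - q) - h) i j‖ ≤ 3 * (Fintype.card κ : ℝ) ^ 2 * r := by
  have hleft (p : κ) : ‖(q * h) i p‖ ≤ Fintype.card κ * r :=
    norm_mul_apply_le fun k =>
      calc ‖q i k‖ * ‖h k p‖ ≤ (l i * l k) * max ‖h k p‖ ‖h p k‖ := by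
            gcongr
            · exact mul_nonneg (hl i) (hl k)
            · exact hq i k
            · exact le_max_left _ _
        _ ≤ l i * t := by rw [mul_assoc]; exact mul_le_mul_of_nonneg_left (hh k p) (hl i)
        _ ≤ r := hi
  have hright : ‖(h * q) i j‖ ≤ Fintype.card κ * r :=
    norm_mul_apply_le fun k =>
      calc ‖h i k‖ * ‖q k j‖ ≤ max ‖h k i‖ ‖h i k‖ * (l k * l j) := by
            gcongr
            · exact le_max_right _ _
            · exact hq k j
        _ = l j * (l k * max ‖h k i‖ ‖h i k‖) := by ring
        _ ≤ l j * t := mul_le_mul_of_nonneg_left (hh k i) (hl j)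
        _ ≤ r := hj
  have hboth : ‖(q * h * q) i j‖ ≤ Fintype.card κ * (Fintype.card κ * r) :=
    norm_mul_apply_le fun k => (mul_le_of_le_one_right (norm_nonneg _)
      ((hq k j).trans (mul_le_one₀ (hl1 k) (hl j) (hl1 j)))).trans (hleft k)
  have hcard : Fintype.card κ * r ≤ Fintype.card κ * (Fintype.card κ * r) :=
    le_mul_of_one_le_left ((norm_nonneg _).trans hright)
      (by exact_mod_cast Fintype.card_pos_iff.mpr ⟨i⟩)
  have hexpand : (1 - q) * h * (1 - q) - h = q * h * q - q * h - h * q := by noncomm_ring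
  calc ‖((1 - q) * h * (1 - q) - h) i j‖
      ≤ ‖(q * h * q) i j‖ + ‖(q * h) i j‖ + ‖(h * q) i j‖ := by
        rw [hexpand]
        exact (norm_sub_le _ _).trans (by gcongr; exact norm_sub_le _ _)
    _ ≤ 3 * (Fintype.card κ * (Fintype.card κ * r)) := by linarith [hleft j]
    _ = 3 * (Fintype.card κ : ℝ) ^ 2 * r := by ring

end EntryBounds

section AlignedCompression

variable {n m : ℕ} {S T V U K : Matrix (Fin n) (Fin n) ℂ} {lam ν : Fin n → ℝ} {ε ρ μ α : ℝ}

/-- The compression of `K` to the projections of the kept columns of `V` onto the span of the kept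
columns of `U`; a `*`-congruent copy of `thresholded K U ν ε`, comparable with
`thresholded K V lam ε`. -/
noncomputable def alignedCompression (K V U : Matrix (Fin n) (Fin n) ℂ) (lam ν : Fin n → ℝ)
    (ε : ℝ) : Matrix (Kept lam ε) (Kept lam ε) ℂ :=
  (overlap V U lam ν ε)ᴴ * thresholded K U ν ε * overlap V U lam ν ε

theorem alignedCompression_eq_submatrix (hV : IsEigendecomposition S V lam)
    (hU : IsEigendecomposition T U ν) (K : Matrix (Fin n) (Fin n) ℂ) :
    let Q := Vᴴ * discardedColumns U ν ε * (Vᴴ * discardedColumns U ν ε)ᴴ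
    alignedCompression K V U lam ν ε =
      ((1 - Q) * (Vᴴ * K * V) * (1 - Q)).submatrix Subtype.val Subtype.val := by
  intro Q
  set C := keptColumns U ν ε
  have hQ : 1 - Q = Vᴴ * (C * Cᴴ) * V := by
    rw [eq_sub_of_add_eq hU.keptColumns_mul_add_discardedColumns_mul, Matrix.mul_sub,
      Matrix.sub_mul, Matrix.mul_one, hV.conjTranspose_mul_self]
    simp only [Q, conjTranspose_mul, conjTranspose_conjTranspose, Matrix.mul_assoc]
  have hfull : (1 - Q) * (Vᴴ * K * V) * (1 - Q) = Vᴴ * (C * (Cᴴ * K * C) * Cᴴ) * V :=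
    calc _ = Vᴴ * (C * Cᴴ) * (V * Vᴴ) * K * (V * Vᴴ) * (C * Cᴴ) * V := by
          rw [hQ]; simp only [Matrix.mul_assoc]
      _ = _ := by
          rw [hV.self_mul_conjTranspose]; simp only [Matrix.mul_assoc, Matrix.one_mul]
  calc alignedCompression K V U lam ν ε
      = (keptColumns V lam ε)ᴴ * (C * (Cᴴ * K * C) * Cᴴ) * keptColumns V lam ε := by
        rw [alignedCompression, overlap, thresholded, conjTranspose_mul,
          conjTranspose_conjTranspose]
        simp only [C, Matrix.mul_assoc]
    _ = _ := by rw [hfull]; rfl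

theorem norm_alignedCompression_le (hV : IsEigendecomposition S V lam)
    (hU : IsEigendecomposition T U ν) (K : Matrix (Fin n) (Fin n) ℂ) :
    ‖alignedCompression K V U lam ν ε‖ ≤ ‖K‖ := by
  have hUV : ‖overlap V U lam ν ε‖ ≤ 1 :=
    norm_conjTranspose_mul_le_one hU.keptColumns_isometry hV.keptColumns_isometry
  have hU1 := norm_le_one_of_conjTranspose_mul_self (hU.keptColumns_isometry (ε := ε))
  exact (norm_conjTranspose_mul_mul_le hUV hUV _).trans (norm_conjTranspose_mul_mul_le hU1 hU1 K)

theorem alignedCompression_add (K L V U : Matrix (Fin n) (Fin n) ℂ) (lam ν : Fin n → ℝ)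
    (ε : ℝ) : alignedCompression (K + L) V U lam ν ε =
      alignedCompression K V U lam ν ε + alignedCompression L V U lam ν ε := by
  simp only [alignedCompression, thresholded_add, Matrix.mul_add, Matrix.add_mul]

theorem norm_alignedCompression_sub_le (hS : S.PosSemidef) (hV : IsEigendecomposition S V lam)
    (hU : IsEigendecomposition T U ν) (hε : 0 < ε) (hμ : 0 ≤ μ) (hα : 0 ≤ α) (hα1 : α ≤ 1)
    (hρ : 0 < ρ) (hgeo : GeometricMeanBound K V lam μ α)
    (hgap : SpectralGap lam m ‖T - S‖ ε ρ) (hnoise : (1 + ρ⁻¹) * ‖T - S‖ ≤ ε) :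
    ‖alignedCompression K V U lam ν ε - thresholded K V lam ε‖ ≤
      3 * μ * (n : ℝ) ^ 3 * (1 + ρ⁻¹) * (‖S‖ / ε) ^ α * ‖T - S‖ := by
  set l := leakage V U ν ε
  have hl : ∀ i, 0 ≤ l i := leakage_nonneg V U ν ε
  set r := μ * (‖S‖ / ε) ^ α * ((1 + ρ⁻¹) * ‖T - S‖) with hr
  have hkept (i : Kept lam ε) : l i * (μ * (ε * (‖S‖ / ε) ^ α)) ≤ r :=
    calc l i * (μ * (ε * (‖S‖ / ε) ^ α)) = μ * (‖S‖ / ε) ^ α * (l i * ε) := by ring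
      _ ≤ μ * (‖S‖ / ε) ^ α * (l i * lam i) := by
          gcongr
          · exact hl i
          · exact i.2.le
      _ ≤ r := mul_le_mul_of_nonneg_left (hgap.leakage_mul_le_noise hV hU hε hρ i.2)
          (by positivity)
  have hentry (i j : Kept lam ε) :
      ‖(alignedCompression K V U lam ν ε - thresholded K V lam ε) i j‖ ≤ 3 * (n : ℝ) ^ 2 * r := by
    have h := norm_one_sub_mul_mul_one_sub_sub_apply_le hl (leakage_le_one hV hU)
      (norm_mul_conjTranspose_apply_le _) (hgeo.leakage_mul_max_norm_le hS hV hU hε hμ hα hα1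
        (hgap.leakage_mul_le_threshold hS hV hU hε hρ hnoise)) (hkept i) (hkept j)
    rw [Fintype.card_fin] at h
    rwa [alignedCompression_eq_submatrix hV hU, thresholded_eq_submatrix]
  calc _ ≤ Fintype.card (Kept lam ε) * (3 * (n : ℝ) ^ 2 * r) :=
        norm_le_card_mul_of_entry_le _ (by positivity) hentry
    _ ≤ n * (3 * (n : ℝ) ^ 2 * r) := by
        gcongr
        exact_mod_cast (Fintype.card_subtype_le _).trans_eq (Fintype.card_fin n)
    _ = _ := by rw [hr]; ring

theorem norm_alignedCompression_add_sub_le (hS : S.PosSemidef)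
    (hV : IsEigendecomposition S V lam) (hU : IsEigendecomposition T U ν) (hε : 0 < ε)
    (hμ : 0 ≤ μ) (hα : 0 ≤ α) (hα1 : α ≤ 1) (hρ : 0 < ρ)
    (hgeo : GeometricMeanBound K V lam μ α) (hgap : SpectralGap lam m ‖T - S‖ ε ρ)
    (hnoise : (1 + ρ⁻¹) * ‖T - S‖ ≤ ε) (Δ : Matrix (Fin n) (Fin n) ℂ) :
    ‖alignedCompression (K + Δ) V U lam ν ε - thresholded K V lam ε‖ ≤
      3 * μ * (n : ℝ) ^ 3 * (1 + ρ⁻¹) * (‖S‖ / ε) ^ α * ‖T - S‖ + ‖Δ‖ := by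
  rw [alignedCompression_add, add_sub_right_comm]
  exact (norm_add_le _ _).trans (add_le_add
    (norm_alignedCompression_sub_le hS hV hU hε hμ hα hα1 hρ hgeo hgap hnoise)
    (norm_alignedCompression_le hV hU Δ))

theorem sqrt_norm_alignedCompression_sub_le {H ΔH ΔS : Matrix (Fin n) (Fin n) ℂ}
    (hS : S.PosSemidef) (hV : IsEigendecomposition S V lam)
    (hU : IsEigendecomposition (S + ΔS) U ν) (hε : 0 < ε) (hμ : 0 ≤ μ) (hα : 0 ≤ α) (hα1 : α ≤ 1)
    (hρ : 0 < ρ) (hgeo : GeometricMeanBound H V lam μ α)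
    (hgap : SpectralGap lam m ‖ΔS‖ ε ρ) (hnoise : (1 + ρ⁻¹) * ‖ΔS‖ ≤ ε) :
    √(‖alignedCompression (H + ΔH) V U lam ν ε - thresholded H V lam ε‖ ^ 2 +
      ‖alignedCompression (S + ΔS) V U lam ν ε - thresholded S V lam ε‖ ^ 2) ≤
      errorLevel S μ α ρ ε ‖ΔS‖ ‖ΔH‖ := by
  have hΔ : S + ΔS - S = ΔS := add_sub_cancel_left S ΔS
  have hA := norm_alignedCompression_add_sub_le hS hV hU hε hμ hα hα1 hρ hgeo
    (by rwa [hΔ]) (by rwa [hΔ]) ΔH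
  have hB := norm_alignedCompression_add_sub_le hS hV hU hε zero_le_one hα hα1 hρ
    (hV.geometricMeanBound hS α) (by rwa [hΔ]) (by rwa [hΔ]) ΔS
  rw [hΔ] at hA hB
  obtain ⟨i⟩ := hgap.nonempty_kept
  have hn : (1 : ℝ) ≤ (n : ℝ) ^ 3 :=
    one_le_pow₀ (by exact_mod_cast (Nat.zero_le _).trans_lt i.1.2)
  have hratio : 1 ≤ (‖S‖ / ε) ^ α :=
    Real.one_le_rpow ((one_le_div hε).mpr (i.2.le.trans (hV.eigenvalue_le_norm i))) hα
  have hρ1 : 1 ≤ 1 + ρ⁻¹ := le_add_of_nonneg_right (inv_pos.mpr hρ).le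
  have hnoise_le : ‖ΔS‖ ≤ (n : ℝ) ^ 3 * (1 + ρ⁻¹) * (‖S‖ / ε) ^ α * ‖ΔS‖ :=
    le_mul_of_one_le_left (norm_nonneg _)
      (one_le_mul_of_one_le_of_one_le (one_le_mul_of_one_le_of_one_le hn hρ1) hratio)
  calc _ ≤ √((‖alignedCompression (H + ΔH) V U lam ν ε - thresholded H V lam ε‖ +
        ‖alignedCompression (S + ΔS) V U lam ν ε - thresholded S V lam ε‖) ^ 2) :=
        Real.sqrt_le_sqrt (pow_add_pow_le (norm_nonneg _) (norm_nonneg _) two_ne_zero)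
    _ ≤ errorLevel S μ α ρ ε ‖ΔS‖ ‖ΔH‖ := by
        rw [Real.sqrt_sq (by positivity), errorLevel]
        linarith [norm_nonneg ΔS]

end AlignedCompression

theorem theorem2p4_general {n : ℕ} (H S ΔH ΔS : Matrix (Fin n) (Fin n) ℂ)
    (hH : H.IsHermitian) (hS : S.PosSemidef) (hΔH : ΔH.IsHermitian)
    (V Vt : Matrix (Fin n) (Fin n) ℂ) (lam lamt : Fin n → ℝ)
    (hV : IsEigendecomposition S V lam) (hVt : IsEigendecomposition (S + ΔS) Vt lamt)
    (ε μ α ρ : ℝ) (m : ℕ) (hε : 0 < ε) (hμ : 0 ≤ μ) (hα0 : 0 ≤ α) (hα : α ≤ 1) (hρ : 0 < ρ)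
    (hgeo : GeometricMeanBound H V lam μ α)
    (hgap : SpectralGap lam m ‖ΔS‖ ε ρ)
    (hnoise : (1 + ρ⁻¹) * ‖ΔS‖ / ε ≤ 1)
    (A B : Matrix (Kept lam ε) (Kept lam ε) ℂ)
    (hA : A = thresholded H V lam ε) (hB : B = thresholded S V lam ε)
    (At Bt : Matrix (Kept lamt ε) (Kept lamt ε) ℂ)
    (hAt : At = thresholded (H + ΔH) Vt lamt ε) (hBt : Bt = thresholded (S + ΔS) Vt lamt ε)
    (χ : ℝ) (hχ : χ = errorLevel S μ α ρ ε ‖ΔS‖ ‖ΔH‖) :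
    (∃ A' B' : Matrix (Kept lam ε) (Kept lam ε) ℂ,
      StarCongruent At Bt A' B' ∧
      (∀ (q : ℕ) (E : Fin q → ℝ), IsEigenvalueSequence At Bt E ↔ IsEigenvalueSequence A' B' E) ∧
      √(‖A' - A‖ ^ 2 + ‖B' - B‖ ^ 2) ≤ χ) ∧
    ∀ (c : ℝ) (E : Fin m → ℝ) (E₀ : ℝ) (x₀ : Kept lam ε → ℂ),
      (min m 2 : ℕ) ≤ c →
      IsEigenvalueSequence A B E →
      (∀ j : Fin m, j.val = 0 → E₀ = E j) →
      IsPairEigenvector A B E₀ x₀ → star x₀ ⬝ᵥ x₀ = 1 →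
      c * χ ≤ ε →
      (∀ j : Fin m, j.val = 1 →
        Real.arcsin (c * χ / ε) ≤ Real.arctan (E j) - Real.arctan E₀) →
      ∃ Et₀ : ℝ, IsLeast (pairEigenvalues At Bt) Et₀ ∧
        |Real.arctan E₀ - Real.arctan Et₀| ≤ Real.arcsin (c * χ / eigenangleDist A B x₀) := by
  subst hA hB hAt hBt hχ
  rw [div_le_one hε] at hnoise
  have hcong : StarCongruent _ _ (alignedCompression (H + ΔH) V Vt lam lamt ε)
      (alignedCompression (S + ΔS) V Vt lam lamt ε) :=
    starCongruent_overlap hV hVt hε hρ (by rwa [add_sub_cancel_left])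
      (by rwa [add_sub_cancel_left]) _ _
  have hbound := sqrt_norm_alignedCompression_sub_le (ΔH := ΔH) hS hV hVt hε hμ hα0 hα hρ hgeo
    hgap hnoise
  refine ⟨⟨_, _, hcong, fun _ _ => hcong.isEigenvalueSequence_iff, hbound⟩, ?_⟩
  intro c E E₀ x₀ hc ⟨hmono, x, hx⟩ hE₀ hx₀ hx₀1 hcχ hgapE
  obtain rfl : E₀ = E ⟨0, hgap.1⟩ := hE₀ _ rfl
  have hgapE' (j : Fin m) (hj : j ≠ ⟨0, hgap.1⟩) := (hgapE ⟨1, by grind⟩ rfl).trans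
    (sub_le_sub_right (Real.arctan_mono (hmono (show 1 ≤ j.val by grind))) _)
  have hA' := hcong.isHermitian (thresholded_isHermitian (hH.add hΔH) _ _ _)
  have hB' := hcong.posDef (hVt.thresholded_posDef hε)
  have := hgap.nonempty_kept
  rw [hcong.pairEigenvalues_eq]
  obtain ⟨F, hF⟩ := exists_isLeast_pairEigenvalues hA' hB'
  rw [star_dotProduct_self, Complex.ofReal_eq_one] at hx₀1
  exact ⟨F, hF, abs_arctan_sub_arctan_le (thresholded_isHermitian hH _ _ _)
    (hV.thresholded_posDef hε) hA' hB' hε hV.mul_sqNorm_le_quadForm_thresholded hbound x hx hx₀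
    hx₀1 hc hcχ hgapE' hF⟩

theorem theorem2p4 {n : ℕ} (H S ΔH ΔS : Matrix (Fin n) (Fin n) ℂ)
    (hH : H.IsHermitian) (hS : S.PosSemidef) (hΔH : ΔH.IsHermitian) (hΔS : ΔS.IsHermitian)
    (V Vt : Matrix (Fin n) (Fin n) ℂ) (lam lamt : Fin n → ℝ)
    (hV : IsEigendecomposition S V lam) (hVt : IsEigendecomposition (S + ΔS) Vt lamt)
    (ε μ α ρ : ℝ) (m : ℕ) (hε : 0 < ε) (hμ : 0 < μ) (hα0 : 0 ≤ α) (hα : α ≤ 1 / 2) (hρ : 0 < ρ)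
    (hgeo : GeometricMeanBound H V lam μ α)
    (hgap : SpectralGap lam m ‖ΔS‖ ε ρ)
    (hnoise : (1 + ρ⁻¹) * ‖ΔS‖ / ε ≤ 1)
    (A B : Matrix (Kept lam ε) (Kept lam ε) ℂ)
    (hA : A = thresholded H V lam ε) (hB : B = thresholded S V lam ε)
    (At Bt : Matrix (Kept lamt ε) (Kept lamt ε) ℂ)
    (hAt : At = thresholded (H + ΔH) Vt lamt ε) (hBt : Bt = thresholded (S + ΔS) Vt lamt ε)
    (χ : ℝ) (hχ : χ = errorLevel S μ α ρ ε ‖ΔS‖ ‖ΔH‖) :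
    (∃ A' B' : Matrix (Kept lam ε) (Kept lam ε) ℂ,
      StarCongruent At Bt A' B' ∧
      (∀ (q : ℕ) (E : Fin q → ℝ), IsEigenvalueSequence At Bt E ↔ IsEigenvalueSequence A' B' E) ∧
      √(‖A' - A‖ ^ 2 + ‖B' - B‖ ^ 2) ≤ χ) ∧
    ∀ (E : Fin m → ℝ) (E₀ : ℝ) (x₀ : Kept lam ε → ℂ),
      IsEigenvalueSequence A B E →
      (∀ j : Fin m, j.val = 0 → E₀ = E j) →
      IsPairEigenvector A B E₀ x₀ → star x₀ ⬝ᵥ x₀ = 1 →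
      n * χ ≤ ε →
      (∀ j : Fin m, j.val = 1 →
        Real.arcsin (n * χ / ε) ≤ Real.arctan (E j) - Real.arctan E₀) →
      ∃ Et₀ : ℝ, IsLeast (pairEigenvalues At Bt) Et₀ ∧
        |Real.arctan E₀ - Real.arctan Et₀| ≤ Real.arcsin (n * χ / eigenangleDist A B x₀) := by
  obtain ⟨hclose, hangle⟩ := theorem2p4_general H S ΔH ΔS hH hS hΔH V Vt lam lamt hV hVt ε μ α ρ m
    hε hμ.le hα0 (hα.trans one_half_lt_one.le) hρ hgeo hgap hnoise A B hA hB At Bt hAt hBt χ hχ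
  exact ⟨hclose, fun E E₀ x₀ =>
    hangle n E E₀ x₀ (by exact_mod_cast (min_le_left m 2).trans hgap.2.1)⟩
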